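/- Let $\Gamma$ be a metric graph with underlying finite graph $G$: each edge $e$ of $G$ is identified with a real interval of some length $\ell(e)>0$ (all vertex weights are $0$). A divisor on $\Gamma$ is a finite formal integer combination of points of $\Gamma$; its degree is the sum of its coefficients, and it is effective if all coefficients are nonnegative. A rational function on $\Gamma$ is a continuous function $f\colon\Gamma\to\mathbb{R}$ that is piecewise linear with integer slopes and finitely many pieces on each edge, and $\operatorname{div}(f)$ is the divisor whose coefficient at each point is the sum of the slopes of $f$ in all directions leaving that point. Two divisors are linearly equivalent if they differ by some $\operatorname{div}(f)$. A divisor $D$ has rank at least $r$ if $D-E$ is linearly equivalent to an effective divisor for every effective divisor $E$ of degree $r$. A $g^r_d$ on $\Gamma$ is (the linear equivalence class of) a divisor of degree $d$ and rank at least $r$. For a positive integer $n$, $\Gamma$ is called $n$-gonal if $$n=\min\{j\in\mathbb{Z}_{>0} : \text{there is a } g^1_j \text{ on } \Gamma\}.$$ **Theorem 4.2.** For every choice of positive real edge lengths, the following holds. 1. Every metric graph with underlying graph the complete bipartite graph $K_{3,3}$ is $3$-gonal. 2. Every metric graph with underlying graph the Petersen graph is $4$-gonal. 3. Every metric graph with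 underlying graph the Heawood graph is $5$-gonal. 4. Every metric graph with underlying graph the Pappus graph is $6$-gonal. -/

import Mathlib

/-- A (compact) metric graph with underlying finite graph `G` and all vertex weights zero: every edge
`e` of `G` is identified with a real interval `[0, len e]` of positive length, where `0` corresponds to
the endpoint `src e` and `len e` to the endpoint `tgt e`. The parametrization of the edges is
arbitrary, and so are the edge lengths. -/
structure MetricGraph {V : Type} (G : SimpleGraph V) where
  /-- the initial endpoint of an edge -/
  src : G.edgeSet → V
  /-- the final endpoint of an edge -/
  tgt : G.edgeSet → V
  ends : ∀ e, s(src e, tgt e) = (e : Sym2 V)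
  /-- the length of an edge -/
  len : G.edgeSet → ℝ
  len_pos : ∀ e, 0 < len e

namespace MetricGraph

/-- The points of a metric graph: the vertices, and the interior points of the edges. -/
inductive Point {V : Type} {G : SimpleGraph V} (Γ : MetricGraph G) : Type where
  | vertex (v : V) : Point Γ
  | inner (e : G.edgeSet) (t : Set.Ioo (0 : ℝ) (Γ.len e)) : Point Γ

open Classical in
/-- The point at parameter `t ∈ [0, len e]` of the closed edge `e`; parameters outside of `[0, len e]`
are sent to the nearer endpoint. -/
noncomputable def edgePoint {V : Type} {G : SimpleGraph V} (Γ : MetricGraph G)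
    (e : G.edgeSet) (t : ℝ) : Γ.Point :=
  if h : 0 < t ∧ t < Γ.len e then .inner e ⟨t, h⟩
  else if t ≤ 0 then .vertex (Γ.src e) else .vertex (Γ.tgt e)

/-- `φ` is continuous and piecewise linear with integer slopes on `[0, L]`, with finitely many pieces
`[t i, t (i + 1)]`. -/
def IsIntegralPL (L : ℝ) (φ : ℝ → ℝ) : Prop :=
  ∃ (n : ℕ) (t : ℕ → ℝ) (s : ℕ → ℤ), t 0 = 0 ∧ t n = L ∧
    ∀ i < n, t i ≤ t (i + 1) ∧
      ∀ x ∈ Set.Icc (t i) (t (i + 1)), φ x = φ (t i) + s i * (x - t i)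

/-- Rational functions on a metric graph: continuous real-valued functions that are piecewise linear
with integer slopes on every edge. -/
def IsRational {V : Type} {G : SimpleGraph V} (Γ : MetricGraph G) (f : Γ.Point → ℝ) : Prop :=
  ∀ e, IsIntegralPL (Γ.len e) (fun t => f (Γ.edgePoint e t))

/-- The slope of `f` along the edge `e` at parameter `t`, in the direction of increasing parameter. -/
noncomputable def rightSlope {V : Type} {G : SimpleGraph V} (Γ : MetricGraph G) (f : Γ.Point → ℝ)
    (e : G.edgeSet) (t : ℝ) : ℝ :=
  derivWithin (fun u => f (Γ.edgePoint e u)) (Set.Ioi t) t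

/-- The derivative from the left of `f` along the edge `e` at parameter `t`; the slope of `f` in the
direction of decreasing parameter is its negative. -/
noncomputable def leftSlope {V : Type} {G : SimpleGraph V} (Γ : MetricGraph G) (f : Γ.Point → ℝ)
    (e : G.edgeSet) (t : ℝ) : ℝ :=
  derivWithin (fun u => f (Γ.edgePoint e u)) (Set.Iio t) t

open Classical in
/-- The order of `f` at a point: the sum of the slopes of `f` over all directions leaving the point. -/
noncomputable def ord {V : Type} [Fintype V] {G : SimpleGraph V} (Γ : MetricGraph G)
    (f : Γ.Point → ℝ) : Γ.Point → ℝ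
  | .vertex v => ∑ e : G.edgeSet,
      ((if Γ.src e = v then Γ.rightSlope f e 0 else 0)
        - (if Γ.tgt e = v then Γ.leftSlope f e (Γ.len e) else 0))
  | .inner e t => Γ.rightSlope f e t - Γ.leftSlope f e t

/-- Divisors (configurations of points): finite formal integer combinations of points. -/
abbrev Divisor {V : Type} {G : SimpleGraph V} (Γ : MetricGraph G) : Type := Γ.Point →₀ ℤ

/-- The degree of a divisor. -/
def degree {V : Type} {G : SimpleGraph V} (Γ : MetricGraph G) (D : Γ.Divisor) : ℤ :=
  D.sum fun _ a => a

/-- Linear equivalence: `D - D'` is the divisor of a rational function. -/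
def LinEquiv {V : Type} [Fintype V] {G : SimpleGraph V} (Γ : MetricGraph G)
    (D D' : Γ.Divisor) : Prop :=
  ∃ f : Γ.Point → ℝ, Γ.IsRational f ∧ ∀ x, ((D x - D' x : ℤ) : ℝ) = Γ.ord f x

/-- The (Baker–Norine) rank of `D` is at least `r`: for every effective divisor `E` of degree `r`, the
divisor `D - E` is linearly equivalent to an effective divisor. -/
def RankAtLeast {V : Type} [Fintype V] {G : SimpleGraph V} (Γ : MetricGraph G)
    (D : Γ.Divisor) (r : ℕ) : Prop :=
  ∀ E : Γ.Divisor, 0 ≤ E → Γ.degree E = r → ∃ F : Γ.Divisor, 0 ≤ F ∧ Γ.LinEquiv (D - E) F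

/-- There is a `g^r_d` on `Γ`: a divisor of degree `d` whose rank is at least `r`. -/
def HasLinearSeries {V : Type} [Fintype V] {G : SimpleGraph V} (Γ : MetricGraph G)
    (r : ℕ) (d : ℤ) : Prop :=
  ∃ D : Γ.Divisor, Γ.degree D = d ∧ Γ.RankAtLeast D r

/-- `Γ` is `n`-gonal: `n` is the least positive integer `j` such that there is a `g^1_j` on `Γ`. -/
def IsGonal {V : Type} [Fintype V] {G : SimpleGraph V} (Γ : MetricGraph G) (n : ℤ) : Prop :=
  IsLeast {j : ℤ | 0 < j ∧ Γ.HasLinearSeries 1 j} n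

end MetricGraph

/-- The Levi graph (incidence graph) of an incidence relation between points and lines. -/
def leviGraph {P L : Type} (I : P → L → Prop) : SimpleGraph (P ⊕ L) where
  Adj
    | .inl p, .inr l => I p l
    | .inr l, .inl p => I p l
    | _, _ => False
  symm := ⟨by rintro (a | a) (b | b) h <;> exact h⟩
  loopless := ⟨by rintro (a | a) h <;> exact h⟩

/-- The Petersen graph: the vertices are the two-element subsets of a five-element set, and two of them
are adjacent when they are disjoint. -/
def petersenGraph : SimpleGraph {s : Finset (Fin 5) // s.card = 2} where
  Adj s t := Disjoint s.1 t.1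
  symm := ⟨fun _ _ h => h.symm⟩
  loopless := ⟨by
    rintro ⟨s, hs⟩ h
    have h0 : s = ∅ := by simpa using h
    simp [h0] at hs⟩

/-- The Heawood graph: the Levi graph of the Fano plane, whose lines are the seven translates of
`{0, 1, 3}` in `ℤ/7ℤ`. -/
def heawoodGraph : SimpleGraph (Fin 7 ⊕ Fin 7) :=
  leviGraph fun p l => p = l ∨ p = l + 1 ∨ p = l + 3

/-- The nine lines of the Pappus configuration. The points `A, B, C` are numbered `0, 1, 2`, the points
`a, b, c` are numbered `3, 4, 5`, and `X = Ab ∩ aB`, `Y = Ac ∩ aC`, `Z = Bc ∩ bC` are numbered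
`6, 7, 8`. -/
def pappusLine : Fin 9 → Finset (Fin 9) :=
  ![{0, 1, 2}, {3, 4, 5}, {6, 7, 8}, {0, 4, 6}, {1, 3, 6}, {0, 5, 7}, {2, 3, 7}, {1, 5, 8}, {2, 4, 8}]

/-- The Pappus graph: the Levi graph of the Pappus configuration. -/
def pappusGraph : SimpleGraph (Fin 9 ⊕ Fin 9) :=
  leviGraph fun p l => p ∈ pappusLine l

/-! Both bounds come from combinatorics of the underlying graph, so the edge lengths do not matter.

Upper bound (`IsTreeCover.hasLinearSeries`). Each of the four graphs has a set `A` of `n` vertices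
whose complement is a disjoint union of three trees, such that no vertex of `A` has two neighbours
in one tree. Put one chip on each vertex of `A`. Since the vertices determine positive rank
(`rankAtLeast_one_of_vertices`), it is enough to reach each vertex `v` of a tree `T`. Let one chip
on every edge leaving `T` run towards `T`, all at the same speed, until the first arrives at some
`u`. If `u ≠ v`, then every edge leaving the component of `v` in `T - u` again has a chip of its
own: the chip at `u` serves the single edge joining `u` to that component. Induction on the size of
`T` finishes (`IsTreeFamily.exists_reach`).

Lower bound (`not_hasLinearSeries_of_scramble`). A scramble is a family of connected vertex sets,
the eggs. Suppose that no `k` vertices meet all eggs and that more than `k` edges leave any vertex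
set that contains one egg and is disjoint from another. Let `D` have degree at most `k` and positive
rank. Every egg is then hit by some effective divisor equivalent to `D`. Given two such divisors
with `D₂ = D₁ + div f`, truncating `f` at the largest of its minima over the eggs yields `F = D₁ +
div (max f c)`, which hits every egg hit by `D₁` or `D₂` (`exists_hits_of_hits`): an egg can be lost
only if it lies strictly below `c`, and then the cut at level `c` forces more than `k` chips of `F`
(`card_cut_le_degree`). Adding the eggs one by one gives a divisor of degree at most `k` that hits
all of them, and its support projects to `k` or fewer vertices meeting all eggs, a contradiction.

Explicit scrambles are certified by two verified searches (`not_hasLinearSeries_of_search`). -/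

open Filter Topology Set

namespace MetricGraph

/-! ### One-sided germs of piecewise linear functions on the line -/

/-- `φ` is linear with integer slope `s` to the right of `t`. -/
def RGerm (φ : ℝ → ℝ) (t : ℝ) (s : ℤ) : Prop :=
  ∀ᶠ x in 𝓝[>] t, φ x = φ t + s * (x - t)

/-- `φ` is linear with integer slope `s` to the left of `t`. -/
def LGerm (φ : ℝ → ℝ) (t : ℝ) (s : ℤ) : Prop :=
  ∀ᶠ x in 𝓝[<] t, φ x = φ t + s * (x - t)

theorem rGerm_of_Icc {φ : ℝ → ℝ} {a b t : ℝ} {s : ℤ}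
    (h : ∀ x ∈ Icc a b, φ x = φ a + s * (x - a)) (hat : a ≤ t) (htb : t < b) : RGerm φ t s := by
  filter_upwards [Ioo_mem_nhdsGT htb] with x hx
  rw [h x ⟨hat.trans hx.1.le, hx.2.le⟩, h t ⟨hat, htb.le⟩]
  ring

theorem lGerm_of_Icc {φ : ℝ → ℝ} {a b t : ℝ} {s : ℤ}
    (h : ∀ x ∈ Icc a b, φ x = φ a + s * (x - a)) (hat : a < t) (htb : t ≤ b) : LGerm φ t s := by
  filter_upwards [Ioo_mem_nhdsLT hat] with x hx
  rw [h x ⟨hx.1.le, hx.2.le.trans htb⟩, h t ⟨hat.le, htb⟩]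
  ring

/-- Reflection, used to deduce left-hand statements from right-hand ones. -/
theorem rGerm_neg_iff {φ : ℝ → ℝ} {t : ℝ} {s : ℤ} :
    RGerm (fun x => φ (-x)) (-t) s ↔ LGerm φ t (-s) := by
  unfold RGerm LGerm
  have h1 : (𝓝[>] (-t)) = map Neg.neg (𝓝[<] t) := by
    simp
  rw [h1, eventually_map]
  refine eventually_congr (Eventually.of_forall fun x => ?_)
  simp only [neg_neg]
  push_cast
  constructor <;> intro h <;> rw [h] <;> ring

theorem lGerm_neg_iff {φ : ℝ → ℝ} {t : ℝ} {s : ℤ} :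
    LGerm (fun x => φ (-x)) (-t) s ↔ RGerm φ t (-s) := by
  have := rGerm_neg_iff (φ := fun x => φ (-x)) (t := -t) (s := -s)
  simpa using this.symm

theorem RGerm.congr {φ ψ : ℝ → ℝ} {a b t : ℝ} {s : ℤ} (h : RGerm φ t s)
    (hφ : ∀ x ∈ Icc a b, φ x = ψ x) (ht : t ∈ Ico a b) : RGerm ψ t s := by
  filter_upwards [h, Ioo_mem_nhdsGT ht.2] with x hx hx'
  rw [← hφ x ⟨ht.1.trans hx'.1.le, hx'.2.le⟩, hx, hφ t ⟨ht.1, ht.2.le⟩]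

theorem LGerm.congr {φ ψ : ℝ → ℝ} {a b t : ℝ} {s : ℤ} (h : LGerm φ t s)
    (hφ : ∀ x ∈ Icc a b, φ x = ψ x) (ht : t ∈ Ioc a b) : LGerm ψ t s := by
  filter_upwards [h, Ioo_mem_nhdsLT ht.1] with x hx hx'
  rw [← hφ x ⟨hx'.1.le, hx'.2.le.trans ht.2⟩, hx, hφ t ⟨ht.1.le, ht.2⟩]

theorem RGerm.derivWithin {φ : ℝ → ℝ} {t : ℝ} {s : ℤ} (h : RGerm φ t s) :
    derivWithin φ (Ioi t) t = s := by
  have h1 : HasDerivWithinAt (fun x => φ t + s * (x - t)) (s : ℝ) (Ioi t) t := by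
    have := (((hasDerivAt_id t).sub_const t).const_mul (s : ℝ)).const_add (φ t)
    simpa using this.hasDerivWithinAt
  exact (h1.congr_of_eventuallyEq h (by simp)).derivWithin (uniqueDiffWithinAt_Ioi t)

theorem LGerm.derivWithin {φ : ℝ → ℝ} {t : ℝ} {s : ℤ} (h : LGerm φ t s) :
    derivWithin φ (Iio t) t = s := by
  have h1 : HasDerivWithinAt (fun x => φ t + s * (x - t)) (s : ℝ) (Iio t) t := by
    have := (((hasDerivAt_id t).sub_const t).const_mul (s : ℝ)).const_add (φ t)
    simpa using this.hasDerivWithinAt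
  exact (h1.congr_of_eventuallyEq h (by simp)).derivWithin (uniqueDiffWithinAt_Iio t)

theorem exists_mem_Ico_of_chain {n : ℕ} {t : ℕ → ℝ} {x : ℝ} (h0 : t 0 ≤ x) (hn : x < t n) :
    ∃ i < n, t i ≤ x ∧ x < t (i + 1) := by
  classical
  have hex : ∃ j, x < t j := ⟨n, hn⟩
  have hj := Nat.find_spec hex
  have hjn : Nat.find hex ≤ n := Nat.find_min' hex hn
  have hj0 : Nat.find hex ≠ 0 := fun h => by rw [h] at hj; linarith
  obtain ⟨i, hi⟩ := Nat.exists_eq_succ_of_ne_zero hj0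
  exact ⟨i, by omega, not_lt.1 (Nat.find_min hex (m := i) (by omega)), by rw [hi] at hj; exact hj⟩

theorem exists_mem_Ioc_of_chain {n : ℕ} {t : ℕ → ℝ} {x : ℝ} (h0 : t 0 < x) (hn : x ≤ t n) :
    ∃ i < n, t i < x ∧ x ≤ t (i + 1) := by
  classical
  have hex : ∃ j, x ≤ t j := ⟨n, hn⟩
  have hj := Nat.find_spec hex
  have hjn : Nat.find hex ≤ n := Nat.find_min' hex hn
  have hj0 : Nat.find hex ≠ 0 := fun h => by rw [h] at hj; linarith
  obtain ⟨i, hi⟩ := Nat.exists_eq_succ_of_ne_zero hj0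
  exact ⟨i, by omega, not_le.1 (Nat.find_min hex (m := i) (by omega)), by rw [hi] at hj; exact hj⟩

theorem chain_mono {n : ℕ} {t : ℕ → ℝ} (h : ∀ i < n, t i ≤ t (i + 1)) {i j : ℕ} (hij : i ≤ j)
    (hj : j ≤ n) : t i ≤ t j := by
  induction j, hij using Nat.le_induction with
  | base => exact le_rfl
  | succ j hij ih => exact (ih (by omega)).trans (h j (by omega))

/-- The differences are the indicators of the half-open pieces `[t j, t (j + 1))`, and only the
`i`-th piece contains `x`. -/
theorem sum_Ico_indicator {n : ℕ} {t : ℕ → ℝ} (s : ℕ → ℤ) (h : ∀ i < n, t i ≤ t (i + 1)) {i : ℕ}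
    (hi : i < n) {x : ℝ} (h1 : t i ≤ x) (h2 : x < t (i + 1)) :
    ∑ j ∈ Finset.range n, s j * ((if t j ≤ x then 1 else 0) - (if t (j + 1) ≤ x then 1 else 0))
      = s i := by
  rw [Finset.sum_eq_single i]
  · simp [h1, h2.not_ge]
  · intro j hj hji
    rw [Finset.mem_range] at hj
    rcases lt_or_gt_of_ne hji with hlt | hgt
    · have a1 : t (j + 1) ≤ x := (chain_mono h (show j + 1 ≤ i by omega) hi.le).trans h1
      simp [a1, (h j hj).trans a1]
    · have a1 : x < t j := h2.trans_le (chain_mono h (show i + 1 ≤ j by omega) hj.le)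
      simp [a1.not_ge, (a1.trans_le (h j hj)).not_ge]
  · simp [hi]

theorem sum_Ioc_indicator {n : ℕ} {t : ℕ → ℝ} (s : ℕ → ℤ) (h : ∀ i < n, t i ≤ t (i + 1)) {i : ℕ}
    (hi : i < n) {x : ℝ} (h1 : t i < x) (h2 : x ≤ t (i + 1)) :
    ∑ j ∈ Finset.range n, s j * ((if t j < x then 1 else 0) - (if t (j + 1) < x then 1 else 0))
      = s i := by
  rw [Finset.sum_eq_single i]
  · simp [h1, h2.not_gt]
  · intro j hj hji
    rw [Finset.mem_range] at hj
    rcases lt_or_gt_of_ne hji with hlt | hgt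
    · have a1 : t (j + 1) < x := (chain_mono h (show j + 1 ≤ i by omega) hi.le).trans_lt h1
      simp [a1, (h j hj).trans_lt a1]
    · have a1 : x ≤ t j := h2.trans (chain_mono h (show i + 1 ≤ j by omega) hj.le)
      simp [a1.not_gt, (a1.trans (h j hj)).not_gt]
  · simp [hi]

theorem IsIntegralPL.rGerm {L : ℝ} {φ : ℝ → ℝ} (h : IsIntegralPL L φ) {x : ℝ} (hx : x ∈ Ico 0 L) :
    ∃ s, RGerm φ x s := by
  obtain ⟨n, t, s, h0, hn, h⟩ := h
  obtain ⟨i, hi, h1, h2⟩ := exists_mem_Ico_of_chain (h0.trans_le hx.1) (hn ▸ hx.2)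
  exact ⟨s i, rGerm_of_Icc (h i hi).2 h1 h2⟩

theorem IsIntegralPL.lGerm {L : ℝ} {φ : ℝ → ℝ} (h : IsIntegralPL L φ) {x : ℝ} (hx : x ∈ Ioc 0 L) :
    ∃ s, LGerm φ x s := by
  obtain ⟨n, t, s, h0, hn, h⟩ := h
  obtain ⟨i, hi, h1, h2⟩ := exists_mem_Ioc_of_chain (h0.trans_lt hx.1) (hn ▸ hx.2)
  exact ⟨s i, lGerm_of_Icc (h i hi).2 h1 h2⟩

theorem IsIntegralPL.extend {a b : ℝ} {φ : ℝ → ℝ} {s : ℤ} (h : IsIntegralPL a φ) (hab : a ≤ b)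
    (hs : ∀ x ∈ Icc a b, φ x = φ a + s * (x - a)) : IsIntegralPL b φ := by
  obtain ⟨n, t, σ, h0, hn, h⟩ := h
  refine ⟨n + 1, fun i => if i ≤ n then t i else b, fun i => if i < n then σ i else s,
    by simp [h0], by simp, fun i hi => ?_⟩
  rcases Nat.lt_succ_iff_lt_or_eq.1 hi with hi' | rfl
  · have : i + 1 ≤ n := hi'
    simp only [hi'.le, this, hi', if_true]
    exact h i hi'
  · simp only [le_refl, if_true, lt_irrefl, if_false, show ¬ (i + 1 ≤ i) by omega, hn]
    exact ⟨hab, hs⟩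

/-- Compactness: let `c` be the supremum of the `a` such that `φ` is piecewise linear on `[0, a]`.
The left germ at `c` shows that `c` is attained, and the right germ would push beyond `c` if `c <
L`. -/
theorem isIntegralPL_of_germs {L : ℝ} {φ : ℝ → ℝ} (hL : 0 ≤ L)
    (hr : ∀ x ∈ Ico 0 L, ∃ s, RGerm φ x s) (hl : ∀ x ∈ Ioc 0 L, ∃ s, LGerm φ x s) :
    IsIntegralPL L φ := by
  set S : Set ℝ := {a | a ∈ Icc 0 L ∧ IsIntegralPL a φ} with hS
  have h0 : (0 : ℝ) ∈ S := ⟨⟨le_rfl, hL⟩, 0, fun _ => 0, fun _ => 0, rfl, rfl, by simp⟩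
  have hbdd : BddAbove S := ⟨L, fun a ha => ha.1.2⟩
  set c := sSup S with hc
  have hc0 : 0 ≤ c := le_csSup hbdd h0
  have hcL : c ≤ L := csSup_le ⟨0, h0⟩ fun a ha => ha.1.2
  have hcS : IsIntegralPL c φ := by
    rcases hc0.eq_or_lt with h | hpos
    · rw [← h]; exact h0.2
    obtain ⟨s, hs⟩ := hl c ⟨hpos, hcL⟩
    obtain ⟨y, hy, hyc⟩ := (mem_nhdsLT_iff_exists_Ioo_subset).1 hs
    obtain ⟨a, ha, hya⟩ := exists_lt_of_lt_csSup ⟨0, h0⟩ (show y < sSup S from hy)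
    have hac : a ≤ c := le_csSup hbdd ha
    have key : ∀ x ∈ Icc a c, φ x = φ c + s * (x - c) := by
      intro x hx
      rcases hx.2.eq_or_lt with rfl | hlt
      · simp
      · exact hyc ⟨hya.trans_le hx.1, hlt⟩
    refine ha.2.extend hac (s := s) fun x hx => ?_
    rw [key x hx, key a ⟨le_rfl, hac⟩]
    ring
  rcases hcL.eq_or_lt with h | hlt
  · rwa [← h]
  exfalso
  obtain ⟨s, hs⟩ := hr c ⟨hc0, hlt⟩
  obtain ⟨y, hy, hyc⟩ := (mem_nhdsGT_iff_exists_Ioo_subset).1 hs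
  have hy : c < y := hy
  set b := min L ((c + y) / 2) with hb
  have hcb : c < b := lt_min hlt (by linarith)
  have hby : b < y := (min_le_right _ _).trans_lt (by linarith)
  have : b ∈ S := by
    refine ⟨⟨hc0.trans hcb.le, min_le_left _ _⟩, hcS.extend hcb.le (s := s) fun x hx => ?_⟩
    rcases hx.1.eq_or_lt with rfl | hlt'
    · simp
    · exact hyc ⟨hlt', hx.2.trans_lt hby⟩
  exact absurd (le_csSup hbdd this) (not_le.2 hcb)

/-- `φ` is piecewise linear with integer slopes on both sides of every real number. -/
def HasGerms (φ : ℝ → ℝ) : Prop :=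
  ∀ t, (∃ s, RGerm φ t s) ∧ ∃ s, LGerm φ t s

theorem HasGerms.comp_neg {φ : ℝ → ℝ} (h : HasGerms φ) : HasGerms fun x => φ (-x) := by
  intro t
  obtain ⟨⟨s, hs⟩, s', hs'⟩ := h (-t)
  refine ⟨⟨-s', ?_⟩, -s, ?_⟩
  · have := (rGerm_neg_iff (φ := φ) (t := -t) (s := -s')).2 (by simpa using hs')
    simpa using this
  · have := (lGerm_neg_iff (φ := φ) (t := -t) (s := -s)).2 (by simpa using hs)
    simpa using this

theorem HasGerms.continuous {φ : ℝ → ℝ} (h : HasGerms φ) : Continuous φ := by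
  refine continuous_iff_continuousAt.2 fun t => ?_
  obtain ⟨⟨s, hs⟩, s', hs'⟩ := h t
  have key : ∀ s : ℤ, ContinuousAt (fun x => φ t + s * (x - t)) t := fun s => by fun_prop
  refine continuousAt_iff_continuous_left'_right'.2 ⟨?_, ?_⟩
  · exact (key s').continuousWithinAt.congr_of_eventuallyEq hs' (by simp)
  · exact (key s).continuousWithinAt.congr_of_eventuallyEq hs (by simp)

/-- If all right slopes at level `c` vanish, the level set is closed and can always be continued to
the right, so it fills the interval. -/
theorem HasGerms.exists_rGerm_ne_zero_or_const {φ : ℝ → ℝ} (h : HasGerms φ) {a b c : ℝ}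
    (ha : φ a = c) :
    (∃ t ∈ Ico a b, φ t = c ∧ ∃ s, s ≠ 0 ∧ RGerm φ t s) ∨ ∀ x ∈ Icc a b, φ x = c := by
  refine or_iff_not_imp_left.2 fun hne => ?_
  push Not at hne
  have hcl : IsClosed ({x | φ x = c} ∩ Icc a b) :=
    (isClosed_eq h.continuous continuous_const).inter isClosed_Icc
  refine hcl.Icc_subset_of_forall_exists_gt ha ?_
  rintro x ⟨hx, hxab⟩ y hy
  obtain ⟨s, hs⟩ := (h x).1
  have hs0 : s = 0 := by
    by_contra h0
    exact hne x hxab hx s h0 hs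
  subst hs0
  obtain ⟨z, hz⟩ := (hs.and (Ioc_mem_nhdsGT hy)).exists
  exact ⟨z, by simpa [show φ x = c from hx] using hz.1, hz.2⟩

theorem HasGerms.exists_lGerm_ne_zero_or_const {φ : ℝ → ℝ} (h : HasGerms φ) {a b c : ℝ}
    (hb : φ b = c) :
    (∃ t ∈ Ioc a b, φ t = c ∧ ∃ s, s ≠ 0 ∧ LGerm φ t s) ∨ ∀ x ∈ Icc a b, φ x = c := by
  rcases h.comp_neg.exists_rGerm_ne_zero_or_const (a := -b) (b := -a) (c := c) (by simpa) with
    ⟨t, ht, htc, s, hs, hst⟩ | hcon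
  · refine Or.inl ⟨-t, ⟨by linarith [ht.2], by linarith [ht.1]⟩, htc, -s, by simpa, ?_⟩
    rw [← rGerm_neg_iff, neg_neg]
    exact hst
  · refine Or.inr fun x hx => ?_
    simpa using hcon (-x) ⟨by linarith [hx.2], by linarith [hx.1]⟩

/-- Take the last point of `[a, b]` with `c ≤ φ`. Immediately to its right `φ` is below `c`, which
forces the value `c` and a negative slope. -/
theorem HasGerms.exists_crossing {φ : ℝ → ℝ} (h : HasGerms φ) {a b c : ℝ} (hab : a ≤ b)
    (ha : c ≤ φ a) (hb : φ b < c) : ∃ t ∈ Ico a b, φ t = c ∧ ∃ s < 0, RGerm φ t s := by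
  have hcomp : IsCompact ({x | c ≤ φ x} ∩ Icc a b) :=
    isCompact_Icc.inter_left (isClosed_le continuous_const h.continuous)
  obtain ⟨t, ⟨ht, htab⟩, htmax⟩ := hcomp.exists_isGreatest ⟨a, ha, le_rfl, hab⟩
  have htb : t < b := htab.2.lt_of_ne (by rintro rfl; exact absurd ht (not_le.2 hb))
  have hlt : ∀ᶠ x in 𝓝[>] t, φ x < c := by
    filter_upwards [Ioc_mem_nhdsGT htb] with x hx
    by_contra hcon
    exact absurd (htmax ⟨not_lt.1 hcon, htab.1.trans hx.1.le, hx.2⟩) (not_le.2 hx.1)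
  have hle : φ t ≤ c :=
    le_of_tendsto (h.continuous.continuousAt.continuousWithinAt (s := Ioi t))
      (hlt.mono fun _ => le_of_lt)
  have htc : φ t = c := le_antisymm hle ht
  obtain ⟨s, hs⟩ := (h t).1
  refine ⟨t, ⟨htab.1, htb⟩, htc, s, ?_, hs⟩
  obtain ⟨x, hx1, hx2, hx3⟩ := (hs.and (hlt.and (self_mem_nhdsWithin (s := Ioi t)))).exists
  have hx3 : t < x := hx3
  have h5 : (s : ℝ) * (x - t) < 0 := by linarith
  have : (s : ℝ) < 0 := by
    by_contra h6
    nlinarith [mul_nonneg (not_lt.1 h6) (sub_pos.2 hx3).le]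
  exact_mod_cast this

theorem HasGerms.exists_crossing_left {φ : ℝ → ℝ} (h : HasGerms φ) {a b c : ℝ} (hab : a ≤ b)
    (ha : φ a < c) (hb : c ≤ φ b) : ∃ t ∈ Ioc a b, φ t = c ∧ ∃ s > 0, LGerm φ t s := by
  obtain ⟨t, ht, htc, s, hs, hst⟩ := h.comp_neg.exists_crossing (a := -b) (b := -a) (c := c)
    (by linarith) (by simpa) (by simpa)
  refine ⟨-t, ⟨by linarith [ht.2], by linarith [ht.1]⟩, htc, -s, by omega, ?_⟩
  rw [← rGerm_neg_iff, neg_neg]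
  exact hst

/-! ### Points, directions and slopes on a metric graph -/

section Directions

variable {V : Type} {G : SimpleGraph V} (Γ : MetricGraph G)

theorem edgePoint_of_nonpos (e : G.edgeSet) {t : ℝ} (ht : t ≤ 0) :
    Γ.edgePoint e t = .vertex (Γ.src e) := by
  simp [edgePoint, ht, ht.not_gt]

theorem edgePoint_of_len_le (e : G.edgeSet) {t : ℝ} (ht : Γ.len e ≤ t) :
    Γ.edgePoint e t = .vertex (Γ.tgt e) := by
  have := Γ.len_pos e
  simp [edgePoint, ht.not_gt, (this.trans_le ht).not_ge]

theorem edgePoint_of_mem (e : G.edgeSet) {t : ℝ} (ht : t ∈ Ioo 0 (Γ.len e)) :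
    Γ.edgePoint e t = .inner e ⟨t, ht⟩ := by
  have h : 0 < t ∧ t < Γ.len e := ht
  simp [edgePoint, h]

theorem edgePoint_eq_vertex_iff {e : G.edgeSet} {t : ℝ} {v : V} :
    Γ.edgePoint e t = .vertex v ↔ t ≤ 0 ∧ Γ.src e = v ∨ Γ.len e ≤ t ∧ Γ.tgt e = v := by
  have := Γ.len_pos e
  rcases le_or_gt t 0 with h | h
  · have : ¬ Γ.len e ≤ t := by linarith
    simp [edgePoint_of_nonpos, h, this]
  rcases le_or_gt (Γ.len e) t with h' | h'
  · simp [edgePoint_of_len_le, h', h.not_ge]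
  · simp [edgePoint_of_mem Γ e ⟨h, h'⟩, h.not_ge, h'.not_ge]

theorem edgePoint_eq_inner_iff {e e' : G.edgeSet} {t : ℝ} {u : Ioo (0 : ℝ) (Γ.len e')} :
    Γ.edgePoint e t = .inner e' u ↔ e = e' ∧ t = u := by
  rcases le_or_gt t 0 with h | h
  · have : t ≠ u := by have := u.2.1; intro h; linarith
    simp [edgePoint_of_nonpos, h, this]
  rcases le_or_gt (Γ.len e) t with h' | h'
  · have : e = e' → t ≠ u := by rintro rfl h; have := u.2.2; linarith
    simp only [edgePoint_of_len_le, h', reduceCtorEq, false_iff, not_and]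
    exact this
  · rw [edgePoint_of_mem Γ e ⟨h, h'⟩]
    constructor
    · rintro h
      cases h
      exact ⟨rfl, rfl⟩
    · rintro ⟨rfl, rfl⟩
      rfl

/-- The point at distance `h` in the direction `d = (e, t, b)`, which leaves the point with parameter
`t` on the edge `e` towards increasing parameters if `b` is true. -/
noncomputable def ray (d : G.edgeSet × ℝ × Bool) (h : ℝ) : Γ.Point :=
  Γ.edgePoint d.1 (if d.2.2 then d.2.1 + h else d.2.1 - h)

@[simp] theorem ray_zero (d : G.edgeSet × ℝ × Bool) : Γ.ray d 0 = Γ.edgePoint d.1 d.2.1 := by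
  simp [ray]

/-- `f` is linear with integer slope `s` in the direction `d`. -/
def HasSlope (f : Γ.Point → ℝ) (d : G.edgeSet × ℝ × Bool) (s : ℤ) : Prop :=
  ∀ᶠ h in 𝓝[>] (0 : ℝ), f (Γ.ray d h) = f (Γ.ray d 0) + s * h

variable {Γ}

theorem hasSlope_true {f : Γ.Point → ℝ} {e : G.edgeSet} {t : ℝ} {s : ℤ} :
    Γ.HasSlope f (e, t, true) s ↔ RGerm (fun u => f (Γ.edgePoint e u)) t s := by
  have h1 : 𝓝[>] t = map (fun h => t + h) (𝓝[>] 0) := by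
    simp
  unfold RGerm HasSlope
  rw [h1, eventually_map]
  simp [ray]

theorem hasSlope_false {f : Γ.Point → ℝ} {e : G.edgeSet} {t : ℝ} {s : ℤ} :
    Γ.HasSlope f (e, t, false) s ↔ LGerm (fun u => f (Γ.edgePoint e u)) t (-s) := by
  have h1 : 𝓝[<] t = map (fun h => t - h) (𝓝[>] 0) := by
    simp
  unfold LGerm HasSlope
  rw [h1, eventually_map]
  simp [ray]

/-- `edgePoint` is constant beyond the ends of an edge, so germs exist at all reals and no endpoint
cases arise later. -/
theorem isRational_iff_hasGerms {f : Γ.Point → ℝ} :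
    Γ.IsRational f ↔ ∀ e, HasGerms fun u => f (Γ.edgePoint e u) := by
  constructor
  · intro h e t
    have hL := Γ.len_pos e
    have hr : t < 0 ∨ Γ.len e ≤ t → ∃ s, RGerm (fun u => f (Γ.edgePoint e u)) t s := by
      rintro (ht | ht)
      · refine ⟨0, ?_⟩
        filter_upwards [Ioo_mem_nhdsGT ht] with x hx
        simp [edgePoint_of_nonpos, ht.le, hx.2.le]
      · refine ⟨0, ?_⟩
        filter_upwards [self_mem_nhdsWithin] with x hx
        simp [edgePoint_of_len_le, ht, ht.trans (le_of_lt (show t < x from hx))]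
    have hl : t ≤ 0 ∨ Γ.len e < t → ∃ s, LGerm (fun u => f (Γ.edgePoint e u)) t s := by
      rintro (ht | ht)
      · refine ⟨0, ?_⟩
        filter_upwards [self_mem_nhdsWithin] with x hx
        simp [edgePoint_of_nonpos, ht, (le_of_lt (show x < t from hx)).trans ht]
      · refine ⟨0, ?_⟩
        filter_upwards [Ioo_mem_nhdsLT ht] with x hx
        simp [edgePoint_of_len_le, ht.le, hx.1.le]
    constructor
    · by_cases ht : t < 0 ∨ Γ.len e ≤ t
      · exact hr ht
      · push Not at ht
        exact (h e).rGerm ht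
    · by_cases ht : t ≤ 0 ∨ Γ.len e < t
      · exact hl ht
      · push Not at ht
        exact (h e).lGerm ht
  · intro h e
    exact isIntegralPL_of_germs (Γ.len_pos e).le (fun x _ => (h e x).1) fun x _ => (h e x).2

theorem isRational_iff_hasSlope {f : Γ.Point → ℝ} :
    Γ.IsRational f ↔ ∀ d, ∃ s, Γ.HasSlope f d s := by
  rw [isRational_iff_hasGerms]
  constructor
  · rintro h ⟨e, t, _ | _⟩
    · obtain ⟨s, hs⟩ := (h e t).2
      exact ⟨-s, hasSlope_false.2 (by simpa)⟩
    · obtain ⟨s, hs⟩ := (h e t).1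
      exact ⟨s, hasSlope_true.2 hs⟩
  · intro h e t
    obtain ⟨s, hs⟩ := h (e, t, true)
    obtain ⟨s', hs'⟩ := h (e, t, false)
    exact ⟨⟨s, hasSlope_true.1 hs⟩, -s', hasSlope_false.1 hs'⟩

theorem HasSlope.unique {f : Γ.Point → ℝ} {d : G.edgeSet × ℝ × Bool} {s s' : ℤ}
    (h : Γ.HasSlope f d s) (h' : Γ.HasSlope f d s') : s = s' := by
  obtain ⟨x, hx, hx', hx0⟩ := (h.and (h'.and (self_mem_nhdsWithin (s := Ioi 0)))).exists
  have hx0 : 0 < x := hx0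
  have : (s : ℝ) * x = s' * x := by linarith
  exact_mod_cast mul_right_cancel₀ hx0.ne' this

theorem HasSlope.add {f g : Γ.Point → ℝ} {d : G.edgeSet × ℝ × Bool} {s s' : ℤ}
    (h : Γ.HasSlope f d s) (h' : Γ.HasSlope g d s') :
    Γ.HasSlope (fun x => f x + g x) d (s + s') := by
  filter_upwards [h, h'] with x hx hx'
  rw [hx, hx']
  push_cast
  ring

theorem HasSlope.neg {f : Γ.Point → ℝ} {d : G.edgeSet × ℝ × Bool} {s : ℤ}
    (h : Γ.HasSlope f d s) : Γ.HasSlope (fun x => - f x) d (-s) := by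
  filter_upwards [h] with x hx
  rw [hx]
  push_cast
  ring

theorem HasSlope.tendsto {f : Γ.Point → ℝ} {d : G.edgeSet × ℝ × Bool} {s : ℤ}
    (h : Γ.HasSlope f d s) : Tendsto (fun x => f (Γ.ray d x)) (𝓝[>] 0) (𝓝 (f (Γ.ray d 0))) := by
  refine Tendsto.congr' (EventuallyEq.symm h) ?_
  have : ContinuousAt (fun x : ℝ => f (Γ.ray d 0) + s * x) 0 := by fun_prop
  simpa using this.continuousWithinAt.tendsto (s := Ioi 0)

theorem HasSlope.max_of_gt {f : Γ.Point → ℝ} {d : G.edgeSet × ℝ × Bool} {s : ℤ} {c : ℝ}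
    (h : Γ.HasSlope f d s) (hc : c < f (Γ.ray d 0)) :
    Γ.HasSlope (fun x => max (f x) c) d s := by
  filter_upwards [h, h.tendsto.eventually_const_lt hc] with x hx hx'
  rw [max_eq_left hx'.le, max_eq_left hc.le, hx]

theorem HasSlope.max_of_lt {f : Γ.Point → ℝ} {d : G.edgeSet × ℝ × Bool} {s : ℤ} {c : ℝ}
    (h : Γ.HasSlope f d s) (hc : f (Γ.ray d 0) < c) :
    Γ.HasSlope (fun x => max (f x) c) d 0 := by
  filter_upwards [h.tendsto.eventually_lt_const hc] with x hx'
  rw [max_eq_right hx'.le, max_eq_right hc.le]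
  simp

theorem HasSlope.max_of_eq {f : Γ.Point → ℝ} {d : G.edgeSet × ℝ × Bool} {s : ℤ} {c : ℝ}
    (h : Γ.HasSlope f d s) (hc : f (Γ.ray d 0) = c) :
    Γ.HasSlope (fun x => max (f x) c) d (max s 0) := by
  filter_upwards [h, self_mem_nhdsWithin] with x hx hx0
  have hx0 : 0 < x := hx0
  rw [hx, hc, max_self]
  rcases le_total s 0 with hs | hs
  · have : (s : ℝ) ≤ 0 := by exact_mod_cast hs
    rw [max_eq_right hs, max_eq_right (by nlinarith)]
    simp
  · have : (0 : ℝ) ≤ s := by exact_mod_cast hs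
    rw [max_eq_left hs, max_eq_left (by nlinarith)]

theorem IsRational.add {f g : Γ.Point → ℝ} (hf : Γ.IsRational f) (hg : Γ.IsRational g) :
    Γ.IsRational fun x => f x + g x := by
  rw [isRational_iff_hasSlope] at *
  intro d
  obtain ⟨s, hs⟩ := hf d
  obtain ⟨s', hs'⟩ := hg d
  exact ⟨_, hs.add hs'⟩

theorem IsRational.neg {f : Γ.Point → ℝ} (hf : Γ.IsRational f) :
    Γ.IsRational fun x => - f x := by
  rw [isRational_iff_hasSlope] at *
  intro d
  obtain ⟨s, hs⟩ := hf d
  exact ⟨_, hs.neg⟩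

theorem IsRational.max_const {f : Γ.Point → ℝ} (hf : Γ.IsRational f) (c : ℝ) :
    Γ.IsRational fun x => max (f x) c := by
  rw [isRational_iff_hasSlope] at *
  intro d
  obtain ⟨s, hs⟩ := hf d
  rcases lt_trichotomy (f (Γ.ray d 0)) c with h | h | h
  · exact ⟨_, hs.max_of_lt h⟩
  · exact ⟨_, hs.max_of_eq h⟩
  · exact ⟨_, hs.max_of_gt h⟩

open Classical in
/-- The slope of a rational function in a direction. -/
noncomputable def slope (f : Γ.Point → ℝ) (d : G.edgeSet × ℝ × Bool) : ℤ :=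
  if h : ∃ s, Γ.HasSlope f d s then h.choose else 0

theorem HasSlope.slope_eq {f : Γ.Point → ℝ} {d : G.edgeSet × ℝ × Bool} {s : ℤ}
    (h : Γ.HasSlope f d s) : slope f d = s := by
  have hex : ∃ s, Γ.HasSlope f d s := ⟨s, h⟩
  rw [slope, dif_pos hex]
  exact hex.choose_spec.unique h

theorem IsRational.hasSlope {f : Γ.Point → ℝ} (hf : Γ.IsRational f) (d : G.edgeSet × ℝ × Bool) :
    Γ.HasSlope f d (slope f d) := by
  obtain ⟨s, hs⟩ := isRational_iff_hasSlope.1 hf d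
  rwa [hs.slope_eq]

theorem IsRational.rightSlope_eq {f : Γ.Point → ℝ} (hf : Γ.IsRational f) (e : G.edgeSet) (t : ℝ) :
    Γ.rightSlope f e t = slope f (e, t, true) :=
  (hasSlope_true.1 (hf.hasSlope (e, t, true))).derivWithin

theorem IsRational.leftSlope_eq {f : Γ.Point → ℝ} (hf : Γ.IsRational f) (e : G.edgeSet) (t : ℝ) :
    Γ.leftSlope f e t = - slope f (e, t, false) := by
  rw [← Int.cast_neg]
  exact (hasSlope_false.1 (hf.hasSlope (e, t, false))).derivWithin

end Directions

/-! ### Orders of rational functions, linear equivalence, truncation -/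

section Order

variable {V : Type} [Fintype V] {G : SimpleGraph V} {Γ : MetricGraph G}

open Classical in
/-- The directions leaving a point. -/
noncomputable def dirs : Γ.Point → Finset (G.edgeSet × ℝ × Bool)
  | .vertex v => (Finset.univ.filter fun e => Γ.src e = v).image (fun e => (e, 0, true)) ∪
      (Finset.univ.filter fun e => Γ.tgt e = v).image (fun e => (e, Γ.len e, false))
  | .inner e t => {(e, t.1, true), (e, t.1, false)}

/-- Many parameters are sent to the same endpoint by `edgePoint`; the inequalities keep the genuine
one and exclude directions that point out of the edge. -/
theorem mem_dirs {x : Γ.Point} {e : G.edgeSet} {t : ℝ} {b : Bool} :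
    (e, t, b) ∈ dirs x ↔ Γ.edgePoint e t = x ∧
      (if b then 0 ≤ t ∧ t < Γ.len e else 0 < t ∧ t ≤ Γ.len e) := by
  classical
  have hL := Γ.len_pos e
  cases x with
  | vertex v =>
    simp only [dirs, Finset.mem_union, Finset.mem_image, Finset.mem_filter, Finset.mem_univ,
      true_and, Prod.mk.injEq, edgePoint_eq_vertex_iff]
    cases b
    · simp only [Bool.true_eq_false, and_false, exists_false, false_or, Bool.false_eq_true, if_false]
      constructor
      · rintro ⟨e', h, rfl, rfl, -⟩
        exact ⟨Or.inr ⟨le_rfl, h⟩, hL, le_rfl⟩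
      · rintro ⟨⟨h, -⟩ | ⟨h, h'⟩, h1, h2⟩
        · linarith
        · exact ⟨e, h', rfl, le_antisymm h h2, trivial⟩
    · simp only [Bool.false_eq_true, and_false, exists_false, or_false, if_true]
      constructor
      · rintro ⟨e', h, rfl, rfl, -⟩
        exact ⟨Or.inl ⟨le_rfl, h⟩, le_rfl, hL⟩
      · rintro ⟨⟨h, h'⟩ | ⟨h, -⟩, h1, h2⟩
        · exact ⟨e, h', rfl, le_antisymm h1 h, trivial⟩
        · linarith
  | inner e' u =>
    simp only [dirs, Finset.mem_insert, Finset.mem_singleton, Prod.mk.injEq, edgePoint_eq_inner_iff]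
    have h1 := u.2.1
    have h2 := u.2.2
    cases b
    · simp only [Bool.false_eq_true, and_false, and_true, false_or, if_false]
      refine ⟨fun h => ?_, fun h => h.1⟩
      obtain ⟨rfl, rfl⟩ := h
      exact ⟨⟨rfl, rfl⟩, h1, h2.le⟩
    · simp only [Bool.true_eq_false, and_false, and_true, or_false, if_true]
      refine ⟨fun h => ?_, fun h => h.1⟩
      obtain ⟨rfl, rfl⟩ := h
      exact ⟨⟨rfl, rfl⟩, h1.le, h2⟩

theorem ray_zero_of_mem_dirs {x : Γ.Point} {d : G.edgeSet × ℝ × Bool} (hd : d ∈ dirs x) :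
    Γ.ray d 0 = x := by
  obtain ⟨e, t, b⟩ := d
  rw [ray_zero]
  exact (mem_dirs.1 hd).1

/-- The order of a rational function at a point, as an integer. -/
noncomputable def order (f : Γ.Point → ℝ) (x : Γ.Point) : ℤ :=
  ∑ d ∈ dirs x, slope f d

open Classical in
theorem order_vertex (f : Γ.Point → ℝ) (v : V) : order f (.vertex v) = ∑ e : G.edgeSet,
    ((if Γ.src e = v then slope f (e, 0, true) else 0) +
      (if Γ.tgt e = v then slope f (e, Γ.len e, false) else 0)) := by
  unfold order dirs
  simp only
  rw [Finset.sum_union, Finset.sum_image, Finset.sum_image, Finset.sum_filter, Finset.sum_filter,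
    Finset.sum_add_distrib]
  · intro e _ e' _ h
    simpa using congrArg Prod.fst h
  · intro e _ e' _ h
    simpa using congrArg Prod.fst h
  · rw [Finset.disjoint_left]
    simp only [Finset.mem_image]
    rintro _ ⟨e, -, rfl⟩ ⟨e', -, h⟩
    simpa using congrArg (fun d => d.2.2) h

theorem order_inner (f : Γ.Point → ℝ) (e : G.edgeSet) (t : Ioo (0 : ℝ) (Γ.len e)) :
    order f (.inner e t) = slope f (e, t, true) + slope f (e, t, false) := by
  classical
  unfold order dirs
  simp only
  rw [Finset.sum_pair (by simp)]

theorem IsRational.ord_eq {f : Γ.Point → ℝ} (hf : Γ.IsRational f) (x : Γ.Point) :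
    Γ.ord f x = order f x := by
  classical
  cases x with
  | vertex v =>
    rw [order_vertex, ord]
    push_cast
    refine Finset.sum_congr (by congr!) fun e _ => ?_
    rw [hf.rightSlope_eq, hf.leftSlope_eq]
    split_ifs <;> simp
  | inner e t =>
    rw [order_inner, ord, hf.rightSlope_eq, hf.leftSlope_eq]
    push_cast
    ring

theorem IsRational.order_neg {f : Γ.Point → ℝ} (hf : Γ.IsRational f) (x : Γ.Point) :
    order (fun y => - f y) x = - order f x := by
  rw [order, order, ← Finset.sum_neg_distrib]
  exact Finset.sum_congr rfl fun d _ => (hf.hasSlope d).neg.slope_eq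

/-- The function changes sign, because `LinEquiv` takes the order of `f` to be `D - D'`. In this
form an upward bend of `f` creates chips. -/
theorem linEquiv_iff {D D' : Γ.Divisor} :
    Γ.LinEquiv D D' ↔ ∃ f, Γ.IsRational f ∧ ∀ x, D' x = D x + order f x := by
  constructor
  · rintro ⟨f, hf, h⟩
    refine ⟨_, hf.neg, fun x => ?_⟩
    have := h x
    rw [hf.ord_eq] at this
    have : D x - D' x = order f x := by exact_mod_cast this
    rw [hf.order_neg]
    omega
  · rintro ⟨f, hf, h⟩
    refine ⟨_, hf.neg, fun x => ?_⟩
    rw [hf.neg.ord_eq, hf.order_neg, h]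
    push_cast
    ring

theorem IsRational.order_add {f g : Γ.Point → ℝ} (hf : Γ.IsRational f) (hg : Γ.IsRational g)
    (x : Γ.Point) : order (fun y => f y + g y) x = order f x + order g x := by
  rw [order, order, order, ← Finset.sum_add_distrib]
  exact Finset.sum_congr rfl fun d _ => ((hf.hasSlope d).add (hg.hasSlope d)).slope_eq

theorem LinEquiv.symm {D D' : Γ.Divisor} (h : Γ.LinEquiv D D') : Γ.LinEquiv D' D := by
  rw [linEquiv_iff] at *
  obtain ⟨f, hf, h⟩ := h
  refine ⟨_, hf.neg, fun x => ?_⟩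
  rw [h, hf.order_neg]
  ring

theorem LinEquiv.trans {D D' D'' : Γ.Divisor} (h : Γ.LinEquiv D D') (h' : Γ.LinEquiv D' D'') :
    Γ.LinEquiv D D'' := by
  rw [linEquiv_iff] at *
  obtain ⟨f, hf, h⟩ := h
  obtain ⟨g, hg, h'⟩ := h'
  refine ⟨_, hf.add hg, fun x => ?_⟩
  rw [h', h, hf.order_add hg]
  ring

theorem LinEquiv.add_right {D D' : Γ.Divisor} (h : Γ.LinEquiv D D') (E : Γ.Divisor) :
    Γ.LinEquiv (D + E) (D' + E) := by
  rw [linEquiv_iff] at *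
  obtain ⟨f, hf, h⟩ := h
  refine ⟨f, hf, fun x => ?_⟩
  rw [Finsupp.add_apply, Finsupp.add_apply, h]
  ring

theorem IsRational.order_max_of_gt {f : Γ.Point → ℝ} (hf : Γ.IsRational f) {c : ℝ} {x : Γ.Point}
    (hx : c < f x) : order (fun y => max (f y) c) x = order f x :=
  Finset.sum_congr rfl fun d hd =>
    ((hf.hasSlope d).max_of_gt (by rwa [ray_zero_of_mem_dirs hd])).slope_eq

theorem IsRational.order_max_of_lt {f : Γ.Point → ℝ} (hf : Γ.IsRational f) {c : ℝ} {x : Γ.Point}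
    (hx : f x < c) : order (fun y => max (f y) c) x = 0 :=
  Finset.sum_eq_zero fun d hd =>
    ((hf.hasSlope d).max_of_lt (by rwa [ray_zero_of_mem_dirs hd])).slope_eq

theorem IsRational.order_max_of_eq {f : Γ.Point → ℝ} (hf : Γ.IsRational f) {c : ℝ} {x : Γ.Point}
    (hx : f x = c) : order (fun y => max (f y) c) x = ∑ d ∈ dirs x, max (slope f d) 0 :=
  Finset.sum_congr rfl fun d hd =>
    ((hf.hasSlope d).max_of_eq (by rwa [ray_zero_of_mem_dirs hd])).slope_eq

theorem order_eq_sub (f : Γ.Point → ℝ) (x : Γ.Point) :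
    order f x = ∑ d ∈ dirs x, max (slope f d) 0 - ∑ d ∈ dirs x, max (- slope f d) 0 := by
  rw [order, ← Finset.sum_sub_distrib]
  exact Finset.sum_congr rfl fun d _ => by omega

/-- Below level `c` the result is `D`, above it is `D + div f`, and at level `c` only the rising
slopes survive. -/
theorem IsRational.add_order_max_nonneg {f : Γ.Point → ℝ} (hf : Γ.IsRational f) {D : Γ.Divisor}
    (hD : 0 ≤ D) (hD' : ∀ x, 0 ≤ D x + order f x) (c : ℝ) (x : Γ.Point) :
    0 ≤ D x + order (fun y => max (f y) c) x := by
  have h0 : 0 ≤ D x := hD x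
  rcases lt_trichotomy (f x) c with h | h | h
  · rw [hf.order_max_of_lt h]
    omega
  · rw [hf.order_max_of_eq h]
    exact add_nonneg h0 (Finset.sum_nonneg fun d _ => le_max_right _ _)
  · rw [hf.order_max_of_gt h]
    exact hD' x

/-- Write `P` and `N` for the total rising and falling slopes at `x`. Truncation leaves order `P`,
and `D x + P - N ≥ 0`. -/
theorem IsRational.sum_neg_slope_le {f : Γ.Point → ℝ} (hf : Γ.IsRational f) {D : Γ.Divisor}
    {x : Γ.Point} (hD' : 0 ≤ D x + order f x) :
    ∑ d ∈ dirs x, max (- slope f d) 0 ≤ D x + order (fun y => max (f y) (f x)) x := by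
  rw [hf.order_max_of_eq rfl]
  rw [order_eq_sub] at hD'
  omega

/-- A truncation has a chip wherever, at the level of truncation, there is a chip before or after
the move or the function is not locally constant. This is the source of all chips of truncated
divisors. -/
theorem IsRational.add_order_max_pos {f : Γ.Point → ℝ} (hf : Γ.IsRational f) {D : Γ.Divisor}
    (hD : 0 ≤ D) {x : Γ.Point} (hD' : 0 ≤ D x + order f x)
    (h : 0 < D x ∨ 0 < D x + order f x ∨ ∃ d ∈ dirs x, slope f d ≠ 0) :
    0 < D x + order (fun y => max (f y) (f x)) x := by
  have h0 : 0 ≤ D x := hD x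
  have hP : 0 ≤ ∑ d ∈ dirs x, max (slope f d) 0 := Finset.sum_nonneg fun d _ => le_max_right _ _
  have hN : 0 ≤ ∑ d ∈ dirs x, max (- slope f d) 0 := Finset.sum_nonneg fun d _ => le_max_right _ _
  have hle := hf.sum_neg_slope_le hD'
  have heq := order_eq_sub f x
  rw [hf.order_max_of_eq rfl] at *
  rcases h with h | h | ⟨d, hd, h⟩
  · omega
  · omega
  · rcases lt_or_gt_of_ne h with h | h
    · have := Finset.single_le_sum (f := fun d => max (- slope f d) 0)
        (fun d _ => le_max_right _ _) hd
      omega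
    · have := Finset.single_le_sum (f := fun d => max (slope f d) 0)
        (fun d _ => le_max_right _ _) hd
      omega

end Order

/-! ### Bends: second derivatives along an edge -/

/-- The sum of the coefficients of `q` at the points satisfying `p`. -/
noncomputable def massOf (p : ℝ → Prop) [DecidablePred p] : (ℝ →₀ ℤ) →+ ℤ :=
  Finsupp.liftAddHom fun a => if p a then AddMonoidHom.id ℤ else 0

theorem massOf_single (p : ℝ → Prop) [DecidablePred p] (a : ℝ) (c : ℤ) :
    massOf p (Finsupp.single a c) = if p a then c else 0 := by
  unfold massOf
  rw [Finsupp.liftAddHom_apply_single]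
  split_ifs <;> simp

theorem massOf_eq_sum (p : ℝ → Prop) [DecidablePred p] (q : ℝ →₀ ℤ) :
    massOf p q = ∑ a ∈ q.support, if p a then q a else 0 := by
  unfold massOf
  rw [Finsupp.liftAddHom_apply, Finsupp.sum]
  refine Finset.sum_congr rfl fun a _ => ?_
  split_ifs <;> simp

open Classical in
/-- `φ` is piecewise linear with integer slopes on `[0, L]`, and its slope changes by `q a` at `a`,
where `φ` is regarded as being constant outside of `[0, L]`. -/
structure HasBends (L : ℝ) (φ : ℝ → ℝ) (q : ℝ →₀ ℤ) : Prop where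
  mass : massOf (fun _ => True) q = 0
  right : ∀ t ∈ Ico 0 L, RGerm φ t (massOf (· ≤ t) q)
  left : ∀ t ∈ Ioc 0 L, LGerm φ t (massOf (· < t) q)

theorem RGerm.add {φ ψ : ℝ → ℝ} {t : ℝ} {s s' : ℤ} (h : RGerm φ t s) (h' : RGerm ψ t s') :
    RGerm (fun x => φ x + ψ x) t (s + s') := by
  filter_upwards [h, h'] with x hx hx'
  rw [hx, hx']
  push_cast
  ring

theorem LGerm.add {φ ψ : ℝ → ℝ} {t : ℝ} {s s' : ℤ} (h : LGerm φ t s) (h' : LGerm ψ t s') :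
    LGerm (fun x => φ x + ψ x) t (s + s') := by
  filter_upwards [h, h'] with x hx hx'
  rw [hx, hx']
  push_cast
  ring

theorem HasBends.const (L c : ℝ) : HasBends L (fun _ => c) 0 where
  mass := map_zero _
  right t _ := by simp [RGerm]
  left t _ := by simp [LGerm]

theorem HasBends.add {L : ℝ} {φ ψ : ℝ → ℝ} {q r : ℝ →₀ ℤ} (h : HasBends L φ q)
    (h' : HasBends L ψ r) : HasBends L (fun x => φ x + ψ x) (q + r) where
  mass := by rw [map_add, h.mass, h'.mass, add_zero]
  right t ht := by rw [map_add]; exact (h.right t ht).add (h'.right t ht)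
  left t ht := by rw [map_add]; exact (h.left t ht).add (h'.left t ht)

theorem HasBends.sum {L : ℝ} {ι : Type*} (s : Finset ι) {φ : ι → ℝ → ℝ} {q : ι → ℝ →₀ ℤ}
    (h : ∀ i ∈ s, HasBends L (φ i) (q i)) :
    HasBends L (fun x => ∑ i ∈ s, φ i x) (∑ i ∈ s, q i) := by
  classical
  induction s using Finset.induction_on with
  | empty => simpa using HasBends.const L 0
  | insert i s hi ih =>
    simp only [Finset.sum_insert hi]
    exact (h i (Finset.mem_insert_self i s)).add (ih fun j hj => h j (Finset.mem_insert_of_mem hj))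

theorem HasBends.congr {L : ℝ} {φ ψ : ℝ → ℝ} {q : ℝ →₀ ℤ} (h : HasBends L φ q)
    (hφ : ∀ x ∈ Icc 0 L, φ x = ψ x) : HasBends L ψ q where
  mass := h.mass
  right t ht := (h.right t ht).congr hφ ht
  left t ht := (h.left t ht).congr hφ ht

/-- The function with slope `1` on `[x', x]` if `x' ≤ x`, and with slope `-1` on `[x, x']` otherwise,
which is constant on the remaining intervals. -/
noncomputable def ramp (x x' t : ℝ) : ℝ := (|t - x'| - |t - x|) / 2

/-- The function `|t - a|` bends by `2` at `a`, hence the halving in `ramp`. Adding its divisor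
carries a chip from `x` to `x'`. -/
theorem hasBends_ramp (L x x' : ℝ) :
    HasBends L (ramp x x') (Finsupp.single x' 1 - Finsupp.single x 1) where
  mass := by simp [massOf_single]
  right t _ := by
    have key : ∀ a : ℝ, ∀ᶠ u in 𝓝[>] t, |u - a| = |t - a| + ((if a ≤ t then 2 else 0) - 1) * (u - t) := by
      intro a
      rcases le_or_gt a t with h | h
      · filter_upwards [self_mem_nhdsWithin] with u hu
        have hu : t < u := hu
        rw [abs_of_nonneg (by linarith), abs_of_nonneg (by linarith), if_pos h]
        ring
      · filter_upwards [Ioo_mem_nhdsGT h] with u hu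
        rw [abs_of_nonpos (by linarith [hu.2]), abs_of_nonpos (by linarith), if_neg h.not_ge]
        ring
    filter_upwards [key x, key x'] with u h h'
    rw [map_sub, massOf_single, massOf_single, ramp, ramp, h, h']
    split_ifs <;> push_cast <;> ring
  left t _ := by
    have key : ∀ a : ℝ, ∀ᶠ u in 𝓝[<] t, |u - a| = |t - a| + ((if a < t then 2 else 0) - 1) * (u - t) := by
      intro a
      rcases lt_or_ge a t with h | h
      · filter_upwards [Ioo_mem_nhdsLT h] with u hu
        rw [abs_of_nonneg (by linarith [hu.1]), abs_of_nonneg (by linarith), if_pos h]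
        ring
      · filter_upwards [self_mem_nhdsWithin] with u hu
        have hu : u < t := hu
        rw [abs_of_nonpos (by linarith), abs_of_nonpos (by linarith), if_neg h.not_gt]
        ring
    filter_upwards [key x, key x'] with u h h'
    rw [map_sub, massOf_single, massOf_single, ramp, ramp, h, h']
    split_ifs <;> push_cast <;> ring

/-- A piece of slope `s i` contributes a bend `s i` at its start and `- s i` at its end, so the
total is zero. -/
theorem IsIntegralPL.exists_hasBends {L : ℝ} {φ : ℝ → ℝ} (h : IsIntegralPL L φ) :
    ∃ q, HasBends L φ q := by
  classical
  obtain ⟨n, t, s, h0, hn, h⟩ := h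
  have hmono : ∀ i < n, t i ≤ t (i + 1) := fun i hi => (h i hi).1
  refine ⟨∑ i ∈ Finset.range n, (Finsupp.single (t i) (s i) - Finsupp.single (t (i + 1)) (s i)),
    ?_, ?_, ?_⟩
  · simp [massOf_single]
  · intro x hx
    obtain ⟨i, hi, h1, h2⟩ := exists_mem_Ico_of_chain (h0.trans_le hx.1) (hn ▸ hx.2)
    rw [show massOf (· ≤ x) _ = s i by
      rw [map_sum, ← sum_Ico_indicator s hmono hi h1 h2]
      refine Finset.sum_congr rfl fun j _ => ?_
      rw [map_sub, massOf_single, massOf_single, mul_sub, mul_ite, mul_ite, mul_one, mul_zero]]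
    exact rGerm_of_Icc (h i hi).2 h1 h2
  · intro x hx
    obtain ⟨i, hi, h1, h2⟩ := exists_mem_Ioc_of_chain (h0.trans_lt hx.1) (hn ▸ hx.2)
    rw [show massOf (· < x) _ = s i by
      rw [map_sum, ← sum_Ioc_indicator s hmono hi h1 h2]
      refine Finset.sum_congr rfl fun j _ => ?_
      rw [map_sub, massOf_single, massOf_single, mul_sub, mul_ite, mul_ite, mul_one, mul_zero]]
    exact lGerm_of_Icc (h i hi).2 h1 h2

/-! ### Degrees, divisors of functions, moving chips -/

section

variable {V : Type} {G : SimpleGraph V} {Γ : MetricGraph G}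

theorem degree_add (D D' : Γ.Divisor) : Γ.degree (D + D') = Γ.degree D + Γ.degree D' :=
  Finsupp.sum_add_index' (fun _ => rfl) fun _ _ _ => rfl

theorem degree_sum {ι : Type*} (s : Finset ι) (D : ι → Γ.Divisor) :
    Γ.degree (∑ i ∈ s, D i) = ∑ i ∈ s, Γ.degree (D i) :=
  map_sum (AddMonoidHom.mk' Γ.degree degree_add) D s

theorem degree_single (x : Γ.Point) (c : ℤ) : Γ.degree (Finsupp.single x c) = c :=
  Finsupp.sum_single_index rfl

theorem degree_sub (D D' : Γ.Divisor) : Γ.degree (D - D') = Γ.degree D - Γ.degree D' :=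
  map_sub (AddMonoidHom.mk' Γ.degree degree_add) D D'

theorem HasBends.degree_mapDomain {L : ℝ} {φ : ℝ → ℝ} {q : ℝ →₀ ℤ} (h : HasBends L φ q)
    (p : ℝ → Γ.Point) : Γ.degree (Finsupp.mapDomain p q) = 0 := by
  rw [← h.mass, massOf_eq_sum, degree, Finsupp.sum_mapDomain_index (fun _ => rfl) fun _ _ _ => rfl,
    Finsupp.sum]
  simp

open Classical in
-- The bends at or before `0` are collected at the source, those at or after the length at the
-- target. As all bends add up to zero, the latter equal minus the slope arriving at the target.
theorem mapDomain_edgePoint_vertex {q : ℝ →₀ ℤ} {e : G.edgeSet}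
    (h0 : massOf (fun _ => True) q = 0) (v : V) :
    Finsupp.mapDomain (Γ.edgePoint e) q (.vertex v) =
      (if Γ.src e = v then massOf (· ≤ 0) q else 0) +
        (if Γ.tgt e = v then - massOf (· < Γ.len e) q else 0) := by
  have hL := Γ.len_pos e
  have h1 : - massOf (· < Γ.len e) q = massOf (Γ.len e ≤ ·) q := by
    rw [neg_eq_iff_add_eq_zero, ← h0, massOf_eq_sum, massOf_eq_sum, massOf_eq_sum,
      ← Finset.sum_add_distrib]
    refine Finset.sum_congr rfl fun a _ => ?_
    rcases lt_or_ge a (Γ.len e) with h | h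
    · simp [h, h.not_ge]
    · simp [h, h.not_gt]
  have h2 : ∀ (P : Prop) (F : ℝ → ℤ),
      (if P then ∑ a ∈ q.support, F a else 0) = ∑ a ∈ q.support, if P then F a else 0 := by
    intro P F
    split_ifs <;> simp
  rw [h1, massOf_eq_sum, massOf_eq_sum, Finsupp.mapDomain, Finsupp.sum, Finsupp.finsetSum_apply,
    h2, h2, ← Finset.sum_add_distrib]
  refine Finset.sum_congr rfl fun a ha => ?_
  rw [Finsupp.single_apply, edgePoint_eq_vertex_iff]
  rcases le_or_gt a 0 with h | h
  · have : ¬ Γ.len e ≤ a := by linarith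
    simp [h, this]
  · simp [h.not_ge, ite_and, and_comm]

open Classical in
theorem mapDomain_edgePoint_inner (q : ℝ →₀ ℤ) (e e' : G.edgeSet) (t : Ioo (0 : ℝ) (Γ.len e')) :
    Finsupp.mapDomain (Γ.edgePoint e) q (.inner e' t) =
      if e = e' then massOf (· ≤ t.1) q - massOf (· < t.1) q else 0 := by
  rw [Finsupp.mapDomain, Finsupp.sum, Finsupp.finsetSum_apply, massOf_eq_sum, massOf_eq_sum,
    ← Finset.sum_sub_distrib]
  split_ifs with h
  · refine Finset.sum_congr rfl fun a ha => ?_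
    rw [Finsupp.single_apply, edgePoint_eq_inner_iff]
    rcases lt_trichotomy a t.1 with h' | h' | h'
    · simp [h', h'.le, h'.ne]
    · simp [h', h]
    · simp [h'.not_ge, h'.le, h'.ne']
  · refine Finset.sum_eq_zero fun a ha => ?_
    rw [Finsupp.single_apply, edgePoint_eq_inner_iff]
    simp [h]

variable [Fintype V]

open Classical in
-- The divisor of `f` is the sum of the pushforwards of its bends along the edges; its finiteness
-- and its degree can be read off from this.
theorem order_of_hasBends {f : Γ.Point → ℝ} {q : G.edgeSet → ℝ →₀ ℤ}
    (h : ∀ e, HasBends (Γ.len e) (fun u => f (Γ.edgePoint e u)) (q e)) :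
    Γ.IsRational f ∧ ∀ x, (∑ e, Finsupp.mapDomain (Γ.edgePoint e) (q e)) x = order f x := by
  refine ⟨fun e => isIntegralPL_of_germs (Γ.len_pos e).le (fun t ht => ⟨_, (h e).right t ht⟩)
    fun t ht => ⟨_, (h e).left t ht⟩, fun x => ?_⟩
  have hr : ∀ e, ∀ t ∈ Ico 0 (Γ.len e), slope f (e, t, true) = massOf (· ≤ t) (q e) :=
    fun e t ht => (hasSlope_true.2 ((h e).right t ht)).slope_eq
  have hl : ∀ e, ∀ t ∈ Ioc 0 (Γ.len e), slope f (e, t, false) = - massOf (· < t) (q e) :=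
    fun e t ht => (hasSlope_false.2 (by simpa using (h e).left t ht)).slope_eq
  rw [Finsupp.finsetSum_apply]
  cases x with
  | vertex v =>
    rw [order_vertex]
    refine Finset.sum_congr (by congr!) fun e _ => ?_
    rw [mapDomain_edgePoint_vertex (h e).mass, hr e 0 ⟨le_rfl, Γ.len_pos e⟩,
      hl e _ ⟨Γ.len_pos e, le_rfl⟩]
  | inner e t =>
    rw [order_inner, hr e t ⟨t.2.1.le, t.2.2⟩, hl e t ⟨t.2.1, t.2.2.le⟩,
      Finset.sum_eq_single e]
    · rw [mapDomain_edgePoint_inner, if_pos rfl, sub_eq_add_neg]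
    · intro e' _ hne
      rw [mapDomain_edgePoint_inner, if_neg hne]
    · simp

/-- The divisor of a rational function has degree zero. -/
theorem IsRational.exists_divisor {f : Γ.Point → ℝ} (hf : Γ.IsRational f) :
    ∃ P : Γ.Divisor, (∀ x, P x = order f x) ∧ Γ.degree P = 0 := by
  classical
  choose q hq using fun e => (hf e).exists_hasBends
  refine ⟨_, (order_of_hasBends hq).2, ?_⟩
  rw [degree_sum]
  exact Finset.sum_eq_zero fun e _ => (hq e).degree_mapDomain _

theorem LinEquiv.degree_eq {D D' : Γ.Divisor} (h : Γ.LinEquiv D D') :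
    Γ.degree D = Γ.degree D' := by
  obtain ⟨f, hf, h⟩ := linEquiv_iff.1 h
  obtain ⟨P, hP, h0⟩ := hf.exists_divisor
  have : D' = D + P := by
    ext x
    rw [h, Finsupp.add_apply, hP]
  rw [this, degree_add, h0, add_zero]

/-- Chips may be moved along edges when the distances are the differences of a potential. -/
theorem linEquiv_of_moves {ι : Type} [Fintype ι] {e : ι → G.edgeSet} {x x' : ι → ℝ}
    (hx : ∀ i, x i ∈ Icc 0 (Γ.len (e i))) (hx' : ∀ i, x' i ∈ Icc 0 (Γ.len (e i))) {h : V → ℝ}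
    (hh : ∀ ε, ∀ s : Finset ι, (∀ i, i ∈ s ↔ e i = ε) →
      h (Γ.tgt ε) - h (Γ.src ε) = ∑ i ∈ s, (x i - x' i))
    {D D' : Γ.Divisor} (hD : D' + ∑ i, Finsupp.single (Γ.edgePoint (e i) (x i)) 1 =
      D + ∑ i, Finsupp.single (Γ.edgePoint (e i) (x' i)) 1) : Γ.LinEquiv D D' := by
  classical
  -- Each ramp is normalised to vanish at `0` and gains `x i - x' i` along the edge. By `hh` the
  -- value at the far end is then `h` of the target, so the edges fit together at the vertices.
  set φ : G.edgeSet → ℝ → ℝ := fun ε t =>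
    (∑ i with e i = ε, (ramp (x i) (x' i) t + - ramp (x i) (x' i) 0)) + h (Γ.src ε) with hφ
  have hφ0 : ∀ ε, φ ε 0 = h (Γ.src ε) := by simp [hφ]
  have hφL : ∀ ε, φ ε (Γ.len ε) = h (Γ.tgt ε) := by
    intro ε
    have h1 := hh ε (Finset.univ.filter fun i => e i = ε) (by simp)
    rw [eq_comm, ← sub_eq_iff_eq_add, h1]
    refine Finset.sum_congr rfl fun i hi => ?_
    obtain rfl := (Finset.mem_filter.1 hi).2
    obtain ⟨h2, h3⟩ := hx i
    obtain ⟨h4, h5⟩ := hx' i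
    rw [ramp, ramp, abs_of_nonneg (by linarith), abs_of_nonneg (by linarith),
      abs_of_nonpos (by linarith), abs_of_nonpos (by linarith)]
    ring
  set f : Γ.Point → ℝ := fun p => match p with
    | .vertex v => h v
    | .inner ε t => φ ε t with hf
  have hfφ : ∀ ε, ∀ t ∈ Icc 0 (Γ.len ε), φ ε t = f (Γ.edgePoint ε t) := by
    intro ε t ht
    rcases ht.1.eq_or_lt with rfl | h0
    · rw [edgePoint_of_nonpos Γ ε le_rfl, hφ0]
    rcases ht.2.eq_or_lt with rfl | h1
    · rw [edgePoint_of_len_le Γ ε le_rfl, hφL]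
    · rw [edgePoint_of_mem Γ ε ⟨h0, h1⟩]
  have hb : ∀ ε, HasBends (Γ.len ε) (fun t => f (Γ.edgePoint ε t))
      (∑ i with e i = ε, (Finsupp.single (x' i) 1 - Finsupp.single (x i) 1)) := by
    intro ε
    refine HasBends.congr ?_ (hfφ ε)
    rw [← add_zero (∑ i with e i = ε, _)]
    refine (HasBends.sum _ fun i _ => ?_).add (HasBends.const _ _)
    simpa using (hasBends_ramp _ (x i) (x' i)).add (HasBends.const _ (- ramp (x i) (x' i) 0))
  obtain ⟨hrat, hord⟩ := order_of_hasBends hb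
  refine linEquiv_iff.2 ⟨f, hrat, fun p => ?_⟩
  rw [← hord, ← Finsupp.add_apply]
  congr 1
  have hsum : ∑ ε, Finsupp.mapDomain (Γ.edgePoint ε)
      (∑ i with e i = ε, (Finsupp.single (x' i) (1 : ℤ) - Finsupp.single (x i) 1)) =
      ∑ i, (Finsupp.single (Γ.edgePoint (e i) (x' i)) 1 -
        Finsupp.single (Γ.edgePoint (e i) (x i)) 1) := by
    rw [← Finset.sum_fiberwise Finset.univ e]
    refine Finset.sum_congr rfl fun ε _ => ?_
    rw [← Finsupp.mapDomain.addMonoidHom_apply, map_sum]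
    refine Finset.sum_congr rfl fun i hi => ?_
    rw [map_sub, Finsupp.mapDomain.addMonoidHom_apply, Finsupp.mapDomain.addMonoidHom_apply,
      Finsupp.mapDomain_single, Finsupp.mapDomain_single, (Finset.mem_filter.1 hi).2]
  rw [hsum, Finset.sum_sub_distrib, add_sub, ← hD, add_sub_cancel_right]

end

/-! ### Effective divisors, and positive rank from vertices -/

section

variable {V : Type} {G : SimpleGraph V} {Γ : MetricGraph G}

theorem src_ne_tgt (e : G.edgeSet) : Γ.src e ≠ Γ.tgt e := by
  have h : s(Γ.src e, Γ.tgt e) ∈ G.edgeSet := by rw [Γ.ends]; exact e.2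
  exact G.ne_of_adj h

theorem adj_src_tgt (e : G.edgeSet) : G.Adj (Γ.src e) (Γ.tgt e) := by
  have h : s(Γ.src e, Γ.tgt e) ∈ G.edgeSet := by rw [Γ.ends]; exact e.2
  exact h

theorem sum_le_degree {D : Γ.Divisor} (hD : 0 ≤ D) (S : Finset Γ.Point) :
    ∑ x ∈ S, D x ≤ Γ.degree D := by
  classical
  have h1 : Γ.degree D = ∑ x ∈ S ∪ D.support, D x :=
    Finset.sum_subset Finset.subset_union_right fun x _ hx => by simpa using hx
  rw [h1]
  exact Finset.sum_le_sum_of_subset_of_nonneg Finset.subset_union_left fun x _ _ => hD x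

theorem IsRational.hasGerms {f : Γ.Point → ℝ} (hf : Γ.IsRational f) (e : G.edgeSet) :
    HasGerms fun u => f (Γ.edgePoint e u) :=
  isRational_iff_hasGerms.1 hf e

theorem eq_zero_of_degree_eq_zero {D : Γ.Divisor} (hD : 0 ≤ D) (h : Γ.degree D = 0) : D = 0 := by
  ext x
  have := sum_le_degree hD {x}
  have h0 : 0 ≤ D x := hD x
  simp at this
  simp
  omega

theorem exists_eq_single_of_degree_eq_one {D : Γ.Divisor} (hD : 0 ≤ D) (h : Γ.degree D = 1) :
    ∃ x, D = Finsupp.single x 1 := by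
  classical
  have hne : D ≠ 0 := by
    rintro rfl
    simp [degree] at h
  obtain ⟨x, hx⟩ := Finsupp.ne_iff.1 hne
  have hx' : D x ≠ 0 := hx
  have h0 : 0 ≤ D x := hD x
  refine ⟨x, sub_eq_zero.1 (eq_zero_of_degree_eq_zero (fun y => ?_) ?_)⟩
  · have h1 : 0 ≤ D y := hD y
    rw [Finsupp.sub_apply, Finsupp.single_apply]
    split_ifs with hxy
    · subst hxy
      simp only [Finsupp.coe_zero, Pi.zero_apply]
      omega
    · simpa using h1
  · rw [degree_sub, h, degree_single, sub_self]

theorem edgePoint_ne_of_lt {e : G.edgeSet} {x y : ℝ} (hx : 0 ≤ x) (hxy : x < y)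
    (hy : y ≤ Γ.len e) : Γ.edgePoint e x ≠ Γ.edgePoint e y := by
  rcases hy.eq_or_lt with rfl | hy
  · rw [edgePoint_of_len_le Γ e le_rfl, Ne, edgePoint_eq_vertex_iff]
    rintro (⟨-, h⟩ | ⟨h, -⟩)
    · exact src_ne_tgt e h
    · linarith
  · rw [edgePoint_of_mem Γ e ⟨hx.trans_lt hxy, hy⟩, Ne, edgePoint_eq_inner_iff]
    rintro ⟨-, h⟩
    exact hxy.ne h

theorem pos_of_sum_single_le {ι : Type} [Fintype ι] {p : ι → Γ.Point} {D : Γ.Divisor}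
    (hD : ∑ i, Finsupp.single (p i) 1 ≤ D) (i : ι) : 0 < D (p i) := by
  have h1 : Finsupp.single (p i) 1 ≤ D :=
    (Finset.single_le_sum (f := fun i => Finsupp.single (p i) (1 : ℤ)) (fun j _ => by simp)
      (Finset.mem_univ i)).trans hD
  have h2 := h1 (p i)
  rw [Finsupp.single_eq_same] at h2
  omega

theorem nonneg_of_sum_single_le {ι : Type} [Fintype ι] {p : ι → Γ.Point} {D : Γ.Divisor}
    (hD : ∑ i, Finsupp.single (p i) 1 ≤ D) : 0 ≤ D :=
  (Finset.sum_nonneg fun i _ => by simp).trans hD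

variable [Fintype V]

/-- An effective divisor of degree one is a single point, which can be added back to the effective
representative. -/
theorem rankAtLeast_one_iff {D : Γ.Divisor} :
    Γ.RankAtLeast D 1 ↔ ∀ x, ∃ F : Γ.Divisor, 0 ≤ F ∧ Γ.LinEquiv D F ∧ 0 < F x := by
  classical
  constructor
  · intro h x
    obtain ⟨F, hF, hDF⟩ := h (Finsupp.single x 1) (by simp) (by simp [degree_single])
    refine ⟨F + Finsupp.single x 1, add_nonneg hF (by simp), ?_, ?_⟩
    · simpa using hDF.add_right (Finsupp.single x 1)
    · have : 0 ≤ F x := hF x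
      simp only [Finsupp.add_apply, Finsupp.single_eq_same]
      omega
  · intro h E hE hdeg
    obtain ⟨x, rfl⟩ := exists_eq_single_of_degree_eq_one hE (by simpa using hdeg)
    obtain ⟨F, hF, hDF, hx⟩ := h x
    refine ⟨F - Finsupp.single x 1, fun y => ?_, ?_⟩
    · have h1 : 0 ≤ F y := hF y
      rw [Finsupp.sub_apply, Finsupp.single_apply]
      split_ifs with hxy
      · subst hxy
        simp only [Finsupp.coe_zero, Pi.zero_apply]
        omega
      · simpa using h1
    · rw [sub_eq_add_neg, sub_eq_add_neg]
      exact hDF.add_right _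

theorem IsRational.exists_truncation {f : Γ.Point → ℝ} (hf : Γ.IsRational f) {D : Γ.Divisor}
    (hD : 0 ≤ D) (hD' : ∀ x, 0 ≤ D x + order f x) (c : ℝ) :
    ∃ F : Γ.Divisor, 0 ≤ F ∧ Γ.LinEquiv D F ∧ ∀ x, F x = D x + order (fun y => max (f y) c) x := by
  obtain ⟨P, hP, -⟩ := (hf.max_const c).exists_divisor
  have h : ∀ x, (D + P) x = D x + order (fun y => max (f y) c) x := fun x => by
    rw [Finsupp.add_apply, hP]
  exact ⟨D + P, fun x => by rw [h]; exact hf.add_order_max_nonneg hD hD' c x,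
    linEquiv_iff.2 ⟨_, hf.max_const c, h⟩, h⟩

theorem mem_dirs_true {e : G.edgeSet} {t : ℝ} (ht : t ∈ Ico 0 (Γ.len e)) :
    (e, t, true) ∈ dirs (Γ.edgePoint e t) :=
  mem_dirs.2 ⟨rfl, by simpa using ht⟩

theorem mem_dirs_false {e : G.edgeSet} {t : ℝ} (ht : t ∈ Ioc 0 (Γ.len e)) :
    (e, t, false) ∈ dirs (Γ.edgePoint e t) :=
  mem_dirs.2 ⟨rfl, by simpa using ht⟩

theorem LinEquiv.refl (D : Γ.Divisor) : Γ.LinEquiv D D :=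
  linEquiv_of_moves (ι := Empty) (e := fun i => i.elim) (x := fun i => i.elim)
    (x' := fun i => i.elim) (h := fun _ => 0) (fun i => i.elim) (fun i => i.elim)
    (fun ε s _ => by rw [Finset.eq_empty_of_isEmpty s]; simp) (by simp)

theorem exists_linEquiv_of_moves {ι : Type} [Fintype ι] {e : ι → G.edgeSet} {x x' : ι → ℝ}
    (hx : ∀ i, x i ∈ Icc 0 (Γ.len (e i))) (hx' : ∀ i, x' i ∈ Icc 0 (Γ.len (e i))) {h : V → ℝ}
    (hh : ∀ ε, ∀ s : Finset ι, (∀ i, i ∈ s ↔ e i = ε) →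
      h (Γ.tgt ε) - h (Γ.src ε) = ∑ i ∈ s, (x i - x' i))
    {D : Γ.Divisor} (hD : ∑ i, Finsupp.single (Γ.edgePoint (e i) (x i)) 1 ≤ D) :
    ∃ F : Γ.Divisor, ∑ i, Finsupp.single (Γ.edgePoint (e i) (x' i)) 1 ≤ F ∧ Γ.LinEquiv D F :=
  ⟨D - ∑ i, Finsupp.single (Γ.edgePoint (e i) (x i)) 1 +
    ∑ i, Finsupp.single (Γ.edgePoint (e i) (x' i)) 1,
    le_add_of_nonneg_left (sub_nonneg.2 hD), linEquiv_of_moves hx hx' hh (by abel)⟩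

/-- Two chips on an edge may be moved towards each other until one of them reaches a given point
between them. -/
theorem exists_chip_between {D : Γ.Divisor} (hD : 0 ≤ D) {e : G.edgeSet} {x y t : ℝ} (hx0 : 0 ≤ x)
    (hxt : x ≤ t) (hty : t ≤ y) (hy : y ≤ Γ.len e) (hx : 0 < D (Γ.edgePoint e x))
    (hy' : 0 < D (Γ.edgePoint e y)) :
    ∃ F : Γ.Divisor, 0 ≤ F ∧ Γ.LinEquiv D F ∧ 0 < F (Γ.edgePoint e t) := by
  classical
  rcases hxt.eq_or_lt with rfl | hxt
  · exact ⟨D, hD, LinEquiv.refl D, hx⟩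
  rcases hty.eq_or_lt with rfl | hty
  · exact ⟨D, hD, LinEquiv.refl D, hy'⟩
  -- Equal and opposite displacements cancel, so the potential on the vertices can be zero; `r` is
  -- the time at which the chip nearer to `t` arrives.
  set r := min (t - x) (y - t) with hr
  have hr0 : 0 ≤ r := le_min (by linarith) (by linarith)
  have hr1 : r ≤ t - x := min_le_left _ _
  have hr2 : r ≤ y - t := min_le_right _ _
  set p : Bool → ℝ := fun b => if b then x else y with hp
  set p' : Bool → ℝ := fun b => if b then x + r else y - r with hp'
  obtain ⟨F, hF, hDF⟩ := exists_linEquiv_of_moves (e := fun _ : Bool => e) (x := p) (x' := p')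
    (h := fun _ => 0) (D := D) (by
      rintro (_ | _)
      · exact ⟨by simp [hp]; linarith, by simpa [hp]⟩
      · exact ⟨by simpa [hp], by simp [hp]; linarith⟩) (by
      rintro (_ | _)
      · exact ⟨by simp [hp']; linarith, by simp [hp']; linarith⟩
      · exact ⟨by simp [hp']; linarith, by simp [hp']; linarith⟩) (by
      intro ε s hs
      by_cases h : e = ε
      · have : s = Finset.univ := by
          ext i; simp [hs, h]
        simp [this, hp, hp']
      · have : s = ∅ := by
          ext i; simp [hs, h]
        simp [this]) (by
      intro z
      have hne := edgePoint_ne_of_lt hx0 (hxt.trans hty) hy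
      have h0 : 0 ≤ D z := hD z
      simp only [hp, Fintype.sum_bool, if_true, Bool.false_eq_true, if_false,
        Finsupp.add_apply, Finsupp.single_apply]
      split_ifs with h1 h2 h2
      · exact absurd (h1.trans h2.symm) hne
      · subst h1; omega
      · subst h2; omega
      · omega)
  refine ⟨F, nonneg_of_sum_single_le hF, hDF, ?_⟩
  rcases min_choice (t - x) (y - t) with h | h
  · have := pos_of_sum_single_le hF true
    simpa [hp', hr, h] using this
  · have := pos_of_sum_single_le hF false
    simpa [hp', hr, h] using this

/-- The vertices form a rank-determining set. -/
theorem rankAtLeast_one_of_vertices {D : Γ.Divisor}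
    (h : ∀ v, ∃ F : Γ.Divisor, 0 ≤ F ∧ Γ.LinEquiv D F ∧ 0 < F (.vertex v)) :
    Γ.RankAtLeast D 1 := by
  refine rankAtLeast_one_iff.2 fun p => ?_
  cases p with
  | vertex v => exact h v
  | inner e t =>
    obtain ⟨D₁, hD₁, h₁, hsrc⟩ := h (Γ.src e)
    obtain ⟨D₂, hD₂, h₂, htgt⟩ := h (Γ.tgt e)
    obtain ⟨f, hf, h₁₂⟩ := linEquiv_iff.1 (h₁.symm.trans h₂)
    have hD' : ∀ x, 0 ≤ D₁ x + order f x := fun x => by rw [← h₁₂]; exact hD₂ x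
    -- Truncating at the level of the given point puts chips on both sides of it: going towards
    -- either end, `f` acquires a nonzero slope at this level, or stays constant up to the end,
    -- where `D₁` (source) or `D₂` (target) has a chip.
    obtain ⟨F, hF, hDF, hFx⟩ := hf.exists_truncation hD₁ hD' (f (.inner e t))
    have hpos : ∀ x, f x = f (.inner e t) →
        (0 < D₁ x ∨ 0 < D₂ x ∨ ∃ d ∈ dirs x, slope f d ≠ 0) → 0 < F x := by
      intro x hx h
      rw [hFx, ← hx]
      rw [h₁₂] at h
      exact hf.add_order_max_pos hD₁ (hD' x) h
    have ht : f (Γ.edgePoint e t) = f (.inner e t) := by rw [edgePoint_of_mem Γ e t.2]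
    have hx : ∃ x ∈ Icc 0 t.1, 0 < F (Γ.edgePoint e x) := by
      rcases (hf.hasGerms e).exists_lGerm_ne_zero_or_const (a := 0) ht with
        ⟨x, hx, hxc, s, hs, hsx⟩ | hc
      · refine ⟨x, ⟨hx.1.le, hx.2⟩, hpos _ hxc (Or.inr (Or.inr ⟨_, mem_dirs_false
          ⟨hx.1, hx.2.trans t.2.2.le⟩, ?_⟩))⟩
        have h' : Γ.HasSlope f (e, x, false) (-s) := hasSlope_false.2 (by simpa using hsx)
        rw [h'.slope_eq]
        omega
      · refine ⟨0, ⟨le_rfl, t.2.1.le⟩, hpos _ (hc 0 ⟨le_rfl, t.2.1.le⟩) (Or.inl ?_)⟩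
        rwa [edgePoint_of_nonpos Γ e le_rfl]
    have hy : ∃ y ∈ Icc t.1 (Γ.len e), 0 < F (Γ.edgePoint e y) := by
      rcases (hf.hasGerms e).exists_rGerm_ne_zero_or_const (b := Γ.len e) ht with
        ⟨x, hx, hxc, s, hs, hsx⟩ | hc
      · refine ⟨x, ⟨hx.1, hx.2.le⟩, hpos _ hxc (Or.inr (Or.inr ⟨_, mem_dirs_true
          ⟨t.2.1.le.trans hx.1, hx.2⟩, ?_⟩))⟩
        rwa [(hasSlope_true.2 hsx).slope_eq]
      · refine ⟨Γ.len e, ⟨t.2.2.le, le_rfl⟩, hpos _ (hc _ ⟨t.2.2.le, le_rfl⟩)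
          (Or.inr (Or.inl ?_))⟩
        rwa [edgePoint_of_len_le Γ e le_rfl]
    obtain ⟨x, hx, hFx'⟩ := hx
    obtain ⟨y, hy, hFy⟩ := hy
    obtain ⟨F', hF', hFF', hpos'⟩ := exists_chip_between hF hx.1 hx.2 hy.1 hy.2 hFx' hFy
    refine ⟨F', hF', (h₁.trans hDF).trans hFF', ?_⟩
    rwa [edgePoint_of_mem Γ e t.2] at hpos'

end

/-! ### Lower bound: scrambles -/

section

variable {V : Type} {G : SimpleGraph V} {Γ : MetricGraph G}

/-- The closed subgraph of `Γ` that is induced by a set of vertices. -/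
def span (Γ : MetricGraph G) (E : Finset V) : Set Γ.Point
  | .vertex v => v ∈ E
  | .inner e _ => Γ.src e ∈ E ∧ Γ.tgt e ∈ E

theorem edgePoint_mem_span {E : Finset V} {e : G.edgeSet} (hs : Γ.src e ∈ E) (ht : Γ.tgt e ∈ E)
    (t : ℝ) : Γ.edgePoint e t ∈ Γ.span E := by
  rcases le_or_gt t 0 with h | h
  · rw [edgePoint_of_nonpos Γ e h]; exact hs
  rcases le_or_gt (Γ.len e) t with h' | h'
  · rw [edgePoint_of_len_le Γ e h']; exact ht
  · rw [edgePoint_of_mem Γ e ⟨h, h'⟩]; exact ⟨hs, ht⟩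

/-- Some point in the support of `D` lies on the closed subgraph induced by `E`. -/
def Hits (D : Γ.Divisor) (E : Finset V) : Prop :=
  ∃ x ∈ Γ.span E, 0 < D x

/-- The subgraph of `G` induced by `E` is preconnected. -/
def Linked (G : SimpleGraph V) (E : Finset V) : Prop :=
  ∀ p : V → Prop, (∀ u ∈ E, ∀ w ∈ E, G.Adj u w → p u → p w) → (∃ v ∈ E, p v) → ∀ v ∈ E, p v

theorem exists_edge_of_adj (Γ : MetricGraph G) {u w : V} (h : G.Adj u w) :
    ∃ e, Γ.src e = u ∧ Γ.tgt e = w ∨ Γ.src e = w ∧ Γ.tgt e = u := by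
  have := Γ.ends ⟨s(u, w), h⟩
  exact ⟨_, Sym2.eq_iff.1 this⟩

variable [Fintype V]

/-- If `D + div f` is effective, then `D + div (max f c)` hits the connected sets that are hit by `D`
and on which `f` is not everywhere larger than `c`. -/
theorem hits_truncation {D F : Γ.Divisor} (hD : 0 ≤ D) {f : Γ.Point → ℝ} (hf : Γ.IsRational f)
    (hD' : ∀ x, 0 ≤ D x + order f x) {c : ℝ}
    (hF : ∀ x, F x = D x + order (fun y => max (f y) c) x) {E : Finset V} (hE : Linked G E)
    (hDE : Hits D E) (hc : ∃ v ∈ E, f (.vertex v) ≤ c) : Hits F E := by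
  set g : Γ.Point → ℝ := fun y => max (f y) c with hg
  have hgr : Γ.IsRational g := hf.max_const c
  by_contra hno
  have hmax : ∀ y, max (g y) c = g y := by simp [hg]
  -- If `F` misses `E`, then at level `c` inside `E` there are no chips of `D` and all slopes of `g`
  -- vanish. The level set of `c` therefore spreads over all of the connected `E`, leaving no room
  -- for the chip of `D`.
  have key : ∀ x ∈ Γ.span E, g x = c → ¬ (0 < D x ∨ ∃ d ∈ dirs x, slope g d ≠ 0) := by
    rintro x hx hxc h
    refine hno ⟨x, hx, ?_⟩
    have := hgr.add_order_max_pos hD (hf.add_order_max_nonneg hD hD' c x)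
      (h.imp_right Or.inr)
    rw [hxc] at this
    rw [hF]
    simpa only [hmax] using this
  have hedge : ∀ e, Γ.src e ∈ E → Γ.tgt e ∈ E →
      (g (.vertex (Γ.src e)) = c ∨ g (.vertex (Γ.tgt e)) = c) →
      ∀ t ∈ Icc 0 (Γ.len e), g (Γ.edgePoint e t) = c := by
    intro e hs ht h
    rcases h with h | h
    · rw [← edgePoint_of_nonpos Γ e le_rfl] at h
      refine ((hgr.hasGerms e).exists_rGerm_ne_zero_or_const h).resolve_left ?_
      rintro ⟨t, ht', htc, s, hs0, hst⟩
      refine key _ (edgePoint_mem_span hs ht t) htc (Or.inr ⟨_, mem_dirs_true ht', ?_⟩)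
      rwa [(hasSlope_true.2 hst).slope_eq]
    · rw [← edgePoint_of_len_le Γ e le_rfl] at h
      refine ((hgr.hasGerms e).exists_lGerm_ne_zero_or_const h).resolve_left ?_
      rintro ⟨t, ht', htc, s, hs0, hst⟩
      refine key _ (edgePoint_mem_span hs ht t) htc (Or.inr ⟨_, mem_dirs_false ht', ?_⟩)
      have h' : Γ.HasSlope g (e, t, false) (-s) := hasSlope_false.2 (by simpa using hst)
      rw [h'.slope_eq]
      omega
  have hall : ∀ v ∈ E, g (.vertex v) = c := by
    refine hE _ ?_ ?_
    · intro u hu w hw huw hgu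
      obtain ⟨e, ⟨rfl, rfl⟩ | ⟨rfl, rfl⟩⟩ := Γ.exists_edge_of_adj huw
      · rw [← edgePoint_of_len_le Γ e le_rfl]
        exact hedge e hu hw (Or.inl hgu) _ ⟨(Γ.len_pos e).le, le_rfl⟩
      · rw [← edgePoint_of_nonpos Γ e le_rfl]
        exact hedge e hw hu (Or.inr hgu) _ ⟨le_rfl, (Γ.len_pos e).le⟩
    · obtain ⟨v, hv, hvc⟩ := hc
      exact ⟨v, hv, max_eq_right hvc⟩
  obtain ⟨x, hx, hDx⟩ := hDE
  refine key x hx ?_ (Or.inl hDx)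
  cases x with
  | vertex v => exact hall v hx
  | inner e t =>
    rw [← edgePoint_of_mem Γ e t.2]
    exact hedge e hx.1 hx.2 (Or.inl (hall _ hx.1)) t ⟨t.2.1.le, t.2.2.le⟩

/-- The number of edges leaving a superlevel set of `f` is bounded by the degree. -/
theorem card_cut_le_degree {D F : Γ.Divisor} {f : Γ.Point → ℝ}
    (hf : Γ.IsRational f) (hD' : ∀ x, 0 ≤ D x + order f x) {c : ℝ} (hF0 : 0 ≤ F)
    (hF : ∀ x, F x = D x + order (fun y => max (f y) c) x) (M : Finset (V × V))
    (hM : ∀ m ∈ M, c ≤ f (.vertex m.1) ∧ f (.vertex m.2) < c ∧ G.Adj m.1 m.2) :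
    (M.card : ℤ) ≤ Γ.degree F := by
  classical
  -- On every cut edge, coming from its upper end, the last point not below level `c` has level
  -- exactly `c` and a falling slope towards the lower end.
  have hex : ∀ m ∈ M, ∃ d : G.edgeSet × ℝ × Bool, s(m.1, m.2) = (d.1 : Sym2 V) ∧
      f (Γ.ray d 0) = c ∧ d ∈ dirs (Γ.ray d 0) ∧ slope f d < 0 := by
    intro m hm
    obtain ⟨h1, h2, hadj⟩ := hM m hm
    obtain ⟨e, ⟨hs, ht⟩ | ⟨hs, ht⟩⟩ := Γ.exists_edge_of_adj hadj
    · rw [← hs, ← edgePoint_of_nonpos Γ e le_rfl] at h1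
      rw [← ht, ← edgePoint_of_len_le Γ e le_rfl] at h2
      obtain ⟨t, ht', htc, s, hs0, hst⟩ := (hf.hasGerms e).exists_crossing (Γ.len_pos e).le h1 h2
      refine ⟨(e, t, true), by rw [← hs, ← ht, Γ.ends], by simpa using htc, ?_, ?_⟩
      · rw [ray_zero]
        exact mem_dirs_true ht'
      · rwa [(hasSlope_true.2 hst).slope_eq]
    · rw [← hs, ← edgePoint_of_nonpos Γ e le_rfl] at h2
      rw [← ht, ← edgePoint_of_len_le Γ e le_rfl] at h1
      obtain ⟨t, ht', htc, s, hs0, hst⟩ :=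
        (hf.hasGerms e).exists_crossing_left (Γ.len_pos e).le h2 h1
      refine ⟨(e, t, false), by rw [← hs, ← ht, Sym2.eq_swap, Γ.ends], by simpa using htc, ?_, ?_⟩
      · rw [ray_zero]
        exact mem_dirs_false ht'
      · have h' : Γ.HasSlope f (e, t, false) (-s) := hasSlope_false.2 (by simpa using hst)
        rw [h'.slope_eq]
        omega
  rcases M.eq_empty_or_nonempty with rfl | ⟨m₀, hm₀⟩
  · simpa using sum_le_degree hF0 ∅
  have : Nonempty (G.edgeSet × ℝ × Bool) := ⟨(hex m₀ hm₀).choose⟩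
  choose! d hd1 hd2 hd3 hd4 using hex
  have hinj : Set.InjOn d (M : Set (V × V)) := by
    intro m hm m' hm' h
    have h1 := (hd1 m hm).trans ((congrArg (fun d => (d.1 : Sym2 V)) h).trans (hd1 m' hm').symm)
    obtain ⟨a1, a2, -⟩ := hM m hm
    obtain ⟨b1, b2, -⟩ := hM m' hm'
    rcases Sym2.eq_iff.1 h1 with ⟨h2, h3⟩ | ⟨h2, h3⟩
    · exact Prod.ext h2 h3
    · rw [h2] at a1
      linarith
  -- Group the cut edges by their crossing point: at level `c` the coefficient of `F` is at least
  -- the total descent, and each falling direction contributes at least one.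
  rw [Finset.card_eq_sum_card_image (fun m => Γ.ray (d m) 0) M]
  push_cast
  refine (Finset.sum_le_sum fun x hx => ?_).trans
    (sum_le_degree hF0 (M.image fun m => Γ.ray (d m) 0))
  obtain ⟨m, hm, rfl⟩ := Finset.mem_image.1 hx
  set x := Γ.ray (d m) 0 with hxdef
  have hle := hf.sum_neg_slope_le (hD' x)
  rw [show f x = c from hd2 m hm, ← hF] at hle
  refine le_trans ?_ hle
  rw [← Finset.card_image_of_injOn (f := d) 
    (hinj.mono (Finset.coe_subset.2 (Finset.filter_subset _ _))), Finset.card_eq_sum_ones]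
  push_cast
  calc ∑ i ∈ (M.filter fun m => Γ.ray (d m) 0 = x).image d, (1 : ℤ)
      ≤ ∑ i ∈ (M.filter fun m => Γ.ray (d m) 0 = x).image d, max (- slope f i) 0 := by
        refine Finset.sum_le_sum fun i hi => ?_
        obtain ⟨m', hm', rfl⟩ := Finset.mem_image.1 hi
        have := hd4 m' (Finset.mem_filter.1 hm').1
        omega
    _ ≤ _ := by
        refine Finset.sum_le_sum_of_subset_of_nonneg ?_ fun _ _ _ => le_max_right _ _
        intro i hi
        obtain ⟨m', hm', rfl⟩ := Finset.mem_image.1 hi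
        obtain ⟨h1, h2⟩ := Finset.mem_filter.1 hm'
        rw [← h2]
        exact hd3 m' h1

/-- The identity `max f c = f + max (-f) (-c) + c` shows that truncating `f` from `D₁` and `-f` from
`D₂` gives the same divisor. -/
theorem order_max_eq {f : Γ.Point → ℝ} (hf : Γ.IsRational f) (c : ℝ) (x : Γ.Point) :
    order (fun y => max (f y) c) x = order f x + order (fun y => max (- f y) (-c)) x := by
  rw [← hf.order_add (hf.neg.max_const _)]
  refine Finset.sum_congr rfl fun d _ => ?_
  have h := (hf.add (hf.neg.max_const (-c))).hasSlope d
  refine HasSlope.slope_eq ?_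
  have hmax : ∀ y, max (f y) c = (f y + max (- f y) (-c)) + c := by
    intro y
    rw [max_neg_neg]
    linarith [min_add_max (f y) c]
  filter_upwards [h] with y hy
  rw [hmax, hmax, hy]
  ring

/-- Given two linearly equivalent effective divisors of small degree, there is a third one that hits
all eggs of a scramble that are hit by one of the two. -/
theorem exists_hits_of_hits {𝓔 : Finset (Finset V)} (h𝓔 : 𝓔.Nonempty)
    (hne : ∀ E ∈ 𝓔, E.Nonempty) (hlink : ∀ E ∈ 𝓔, Linked G E) {k : ℕ}
    (hcut : ∀ U : Finset V, ∀ E ∈ 𝓔, ∀ E' ∈ 𝓔, E ⊆ U → Disjoint E' U →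
      ∃ M : Finset (V × V), k < M.card ∧ ∀ m ∈ M, m.1 ∈ U ∧ m.2 ∉ U ∧ G.Adj m.1 m.2)
    {D₁ D₂ : Γ.Divisor} (h₁ : 0 ≤ D₁) (h₂ : 0 ≤ D₂) (h₁₂ : Γ.LinEquiv D₁ D₂)
    (hdeg : Γ.degree D₁ ≤ k) :
    ∃ F : Γ.Divisor, 0 ≤ F ∧ Γ.LinEquiv D₁ F ∧ ∀ E ∈ 𝓔, Hits D₁ E ∨ Hits D₂ E → Hits F E := by
  classical
  obtain ⟨f, hf, hf₁₂⟩ := linEquiv_iff.1 h₁₂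
  have hD' : ∀ x, 0 ≤ D₁ x + order f x := fun x => by rw [← hf₁₂]; exact h₂ x
  have hmin : ∀ E ∈ 𝓔, ∃ v ∈ E, ∀ w ∈ E, f (.vertex v) ≤ f (.vertex w) := fun E hE =>
    Finset.exists_min_image E _ (hne E hE)
  have : Nonempty V := let ⟨E, hE⟩ := h𝓔; ⟨(hne E hE).choose⟩
  choose! m hm hmle using hmin
  -- With `c` the largest minimum of `f` over the vertices of an egg, every egg has a vertex at
  -- level at most `c`, while all vertices of `E₀` are at level at least `c`.
  obtain ⟨E₀, hE₀, hmax⟩ := Finset.exists_max_image 𝓔 (fun E => f (.vertex (m E))) h𝓔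
  set c := f (.vertex (m E₀)) with hc
  obtain ⟨F, hF, hDF, hFx⟩ := hf.exists_truncation h₁ hD' c
  refine ⟨F, hF, hDF, fun E hE h => ?_⟩
  rcases h with h | h
  · exact hits_truncation h₁ hf hD' hFx (hlink E hE) h ⟨m E, hm E hE, hmax E hE⟩
  · refine hits_truncation h₂ hf.neg (c := -c) (fun x => ?_) (fun x => ?_) (hlink E hE) h ?_
    · rw [hf₁₂, hf.order_neg]
      simpa using h₁ x
    · rw [hFx, hf₁₂, order_max_eq hf, add_assoc]
    -- Otherwise `E` lies strictly below `c`, and the superlevel set of `c` separates `E₀` from `E`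
    -- by more than `k` edges.
    · by_contra hno
      push Not at hno
      obtain ⟨M, hMk, hM⟩ := hcut (Finset.univ.filter fun v => c ≤ f (.vertex v)) E₀ hE₀ E hE
        (fun v hv => by simpa using hmle E₀ hE₀ v hv)
        (Finset.disjoint_left.2 fun v hv => by simpa using hno v hv)
      have := card_cut_le_degree hf hD' hF hFx M fun p hp => by simpa using hM p hp
      rw [← hDF.degree_eq] at this
      omega

/-- A metric graph whose underlying graph has a scramble of order larger than `k` has gonality larger
than `k`. -/
theorem not_hasLinearSeries_of_scramble {𝓔 : Finset (Finset V)}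
    (hne : ∀ E ∈ 𝓔, E.Nonempty) (hlink : ∀ E ∈ 𝓔, Linked G E) {k : ℕ}
    (hhit : ∀ S : Finset V, S.card ≤ k → ∃ E ∈ 𝓔, Disjoint E S)
    (hcut : ∀ U : Finset V, ∀ E ∈ 𝓔, ∀ E' ∈ 𝓔, E ⊆ U → Disjoint E' U →
      ∃ M : Finset (V × V), k < M.card ∧ ∀ m ∈ M, m.1 ∈ U ∧ m.2 ∉ U ∧ G.Adj m.1 m.2)
    {j : ℤ} (hj : j ≤ k) : ¬ Γ.HasLinearSeries 1 j := by
  classical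
  rintro ⟨D, hdeg, hD⟩
  rw [rankAtLeast_one_iff] at hD
  obtain ⟨E₀, hE₀, -⟩ := hhit ∅ (by simp)
  have key : ∀ 𝓕 ⊆ 𝓔, ∃ F : Γ.Divisor, 0 ≤ F ∧ Γ.LinEquiv D F ∧ ∀ E ∈ 𝓕, Hits F E := by
    intro 𝓕
    induction 𝓕 using Finset.induction_on with
    | empty =>
      intro _
      obtain ⟨v, -⟩ := hne E₀ hE₀
      obtain ⟨F, hF, hDF, -⟩ := hD (.vertex v)
      exact ⟨F, hF, hDF, by simp⟩
    | insert E 𝓕 _ ih =>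
      intro hsub
      obtain ⟨hE, h𝓕⟩ := Finset.insert_subset_iff.1 hsub
      obtain ⟨D₁, h₁, hD₁, hits₁⟩ := ih h𝓕
      obtain ⟨v, hv⟩ := hne E hE
      obtain ⟨D₂, h₂, hD₂, hits₂⟩ := hD (.vertex v)
      obtain ⟨F, hF, hDF, hits⟩ := exists_hits_of_hits ⟨E₀, hE₀⟩ hne hlink hcut h₁ h₂
        (hD₁.symm.trans hD₂) (by rw [← hD₁.degree_eq, hdeg]; exact hj)
      refine ⟨F, hF, hD₁.trans hDF, fun E' hE' => ?_⟩
      rcases Finset.mem_insert.1 hE' with rfl | hE'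
      · exact hits _ hE (Or.inr ⟨.vertex v, hv, hits₂⟩)
      · exact hits _ (h𝓕 hE') (Or.inl (hits₁ _ hE'))
  obtain ⟨F, hF, hDF, hits⟩ := key 𝓔 subset_rfl
  -- An inner point lies in the span of `E` only if both ends of its edge lie in `E`, so either end
  -- could replace it.
  set π : Γ.Point → V := fun x => match x with
    | .vertex v => v
    | .inner e _ => Γ.src e with hπ
  have hsupp : (F.support.card : ℤ) ≤ k := by
    refine le_trans ?_ (hdeg ▸ hj : Γ.degree D ≤ k)
    rw [hDF.degree_eq, Finset.card_eq_sum_ones]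
    push_cast
    refine Finset.sum_le_sum fun x hx => ?_
    have h1 : 0 ≤ F x := hF x
    have h2 := Finsupp.mem_support_iff.1 hx
    change 1 ≤ F x
    omega
  obtain ⟨E, hE, hdisj⟩ := hhit (F.support.image π) (Finset.card_image_le.trans (by omega))
  obtain ⟨x, hx, hFx⟩ := hits E hE
  have hxE : π x ∈ E := by
    cases x with
    | vertex v => exact hx
    | inner e t => exact hx.1
  exact Finset.disjoint_left.1 hdisj hxE
    (Finset.mem_image_of_mem π (Finsupp.mem_support_iff.2 hFx.ne'))

end

/-! ### Upper bound: moving chips into trees -/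

section

variable {V : Type} {G : SimpleGraph V} {Γ : MetricGraph G}

/-- The edge `e` leaves the set of vertices `T`. -/
def IsBoundary (Γ : MetricGraph G) (T : Finset V) (e : G.edgeSet) : Prop :=
  Γ.src e ∈ T ∧ Γ.tgt e ∉ T ∨ Γ.src e ∉ T ∧ Γ.tgt e ∈ T

/-- A family of sets of vertices that is closed under passing to the connected components after the
removal of a vertex, all of whose members induce a tree. -/
structure IsTreeFamily (G : SimpleGraph V) (𝓕 : Set (Finset V)) : Prop where
  exists_adj : ∀ T ∈ 𝓕, ∃ u ∈ T, ∃ w, w ∉ T ∧ G.Adj u w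
  exists_branch : ∀ T ∈ 𝓕, ∀ u ∈ T, ∀ v ∈ T, v ≠ u → ∃ T' ∈ 𝓕, T' ⊆ T ∧ v ∈ T' ∧ u ∉ T' ∧
    (∀ a ∈ T', ∀ b ∈ T, b ∉ T' → G.Adj a b → b = u) ∧
    ∀ a ∈ T', ∀ a' ∈ T', G.Adj a u → G.Adj a' u → a = a'

/-- Chips of `D` that are not selected by `φ` are left unused. -/
theorem sum_single_le_of_injective {ι κ : Type} [Fintype ι] [Fintype κ] {p : ι → Γ.Point}
    {p' : κ → Γ.Point} {D : Γ.Divisor} (hD : ∑ k, Finsupp.single (p' k) 1 ≤ D) (φ : ι → κ)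
    (hφ : Function.Injective φ) (hp : ∀ i, p i = p' (φ i)) : ∑ i, Finsupp.single (p i) 1 ≤ D := by
  classical
  refine le_trans ?_ hD
  calc ∑ i, Finsupp.single (p i) (1 : ℤ) = ∑ k ∈ Finset.univ.image φ, Finsupp.single (p' k) 1 := by
        rw [Finset.sum_image hφ.injOn]
        exact Finset.sum_congr rfl fun i _ => by rw [hp]
    _ ≤ _ := Finset.sum_le_sum_of_subset_of_nonneg (Finset.subset_univ _) fun k _ _ => by simp

theorem eq_of_ends {e e' : G.edgeSet}
    (h : s(Γ.src e, Γ.tgt e) = s(Γ.src e', Γ.tgt e')) : e = e' := by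
  rw [Γ.ends, Γ.ends] at h
  exact Subtype.ext h

variable [Fintype V]

open Classical in
/-- Chips on all edges leaving a tree can be moved into the tree until they reach a given vertex. -/
theorem IsTreeFamily.exists_reach {𝓕 : Set (Finset V)} (h𝓕 : IsTreeFamily G 𝓕) {T : Finset V}
    (hT : T ∈ 𝓕) {D : Γ.Divisor} {x : G.edgeSet → ℝ}
    (hx : ∀ e, Γ.IsBoundary T e → x e ∈ Icc 0 (Γ.len e))
    (hD : ∑ i : {e // Γ.IsBoundary T e}, Finsupp.single (Γ.edgePoint i.1 (x i.1)) 1 ≤ D)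
    {v : V} (hv : v ∈ T) : ∃ F : Γ.Divisor, 0 ≤ F ∧ Γ.LinEquiv D F ∧ 0 < F (.vertex v) := by
  induction hn : T.card using Nat.strong_induction_on generalizing T D x with
  | _ n ih =>
    subst hn
    -- The distance that the chip on a boundary edge still has to run until it enters `T`.
    set dist : G.edgeSet → ℝ := fun e => if Γ.src e ∈ T then x e else Γ.len e - x e with hdist
    have hne : (Finset.univ : Finset {e // Γ.IsBoundary T e}).Nonempty := by
      obtain ⟨u, hu, w, hw, huw⟩ := h𝓕.exists_adj T hT
      obtain ⟨e, ⟨rfl, rfl⟩ | ⟨rfl, rfl⟩⟩ := Γ.exists_edge_of_adj huw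
      · exact ⟨⟨e, Or.inl ⟨hu, hw⟩⟩, Finset.mem_univ _⟩
      · exact ⟨⟨e, Or.inr ⟨hw, hu⟩⟩, Finset.mem_univ _⟩
    obtain ⟨⟨e₀, he₀⟩, -, hmin⟩ := Finset.exists_min_image _ (fun i => dist i.1) hne
    set m := dist e₀ with hm
    have hmin' : ∀ e, Γ.IsBoundary T e → m ≤ dist e := fun e he => hmin ⟨e, he⟩ (Finset.mem_univ _)
    have hm0 : 0 ≤ m := by
      have := hx e₀ he₀
      rw [hm, hdist]
      dsimp only
      split_ifs <;> linarith [this.1, this.2]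
    set x' : G.edgeSet → ℝ := fun e => if Γ.src e ∈ T then x e - m else x e + m with hx'def
    have hx' : ∀ e, Γ.IsBoundary T e → x' e ∈ Icc 0 (Γ.len e) := by
      intro e he
      have h1 := hmin' e he
      obtain ⟨h2, h3⟩ := hx e he
      rw [hdist] at h1
      rw [hx'def]
      dsimp only at h1 ⊢
      split_ifs at h1 ⊢ <;> constructor <;> linarith
    -- The potential is `-m` on `T` and zero elsewhere, so each boundary chip advances by `m`.
    obtain ⟨F, hF, hDF⟩ := exists_linEquiv_of_moves
      (e := fun i : {e // Γ.IsBoundary T e} => i.1) (x := fun i => x i.1) (x' := fun i => x' i.1)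
      (h := fun w => if w ∈ T then -m else 0) (fun i => hx _ i.2) (fun i => hx' _ i.2) (by
        intro ε s hs
        by_cases hε : Γ.IsBoundary T ε
        · have : s = {⟨ε, hε⟩} := by
            ext i
            rw [hs, Finset.mem_singleton]
            exact ⟨fun h => Subtype.ext h, fun h => congrArg Subtype.val h⟩
          rw [this, Finset.sum_singleton]
          rcases hε with ⟨h1, h2⟩ | ⟨h1, h2⟩ <;> simp [hx'def, h1, h2]
        · have : s = ∅ := by
            ext i
            rw [hs]
            simp only [Finset.notMem_empty, iff_false]
            rintro rfl
            exact hε i.2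
          rw [this, Finset.sum_empty]
          have hiff : Γ.src ε ∈ T ↔ Γ.tgt ε ∈ T := by
            unfold IsBoundary at hε
            tauto
          simp [hiff]) hD
    obtain ⟨u, hu, hu₀, huF⟩ : ∃ u ∈ T, (Γ.src e₀ = u ∧ Γ.tgt e₀ ∉ T ∨ Γ.src e₀ ∉ T ∧ Γ.tgt e₀ = u) ∧
        Γ.edgePoint e₀ (x' e₀) = .vertex u := by
      rcases he₀ with ⟨h1, h2⟩ | ⟨h1, h2⟩
      · refine ⟨_, h1, Or.inl ⟨rfl, h2⟩, Γ.edgePoint_of_nonpos e₀ ?_⟩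
        simp [hx'def, hm, hdist, h1]
      · refine ⟨_, h2, Or.inr ⟨h1, rfl⟩, Γ.edgePoint_of_len_le e₀ ?_⟩
        simp [hx'def, hm, hdist, h1]
    by_cases hvu : v = u
    · refine ⟨F, nonneg_of_sum_single_le hF, hDF, ?_⟩
      have := pos_of_sum_single_le hF ⟨e₀, he₀⟩
      rwa [huF, ← hvu] at this
    obtain ⟨T', hT', hsub, hvT', huT', hbranch, huniq⟩ := h𝓕.exists_branch T hT u hu v hv hvu
    have hcard : T'.card < T.card :=
      Finset.card_lt_card ⟨hsub, fun h => huT' (h hu)⟩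
    have hinner : ∀ e, Γ.IsBoundary T' e → ¬ Γ.IsBoundary T e →
        Γ.src e ∈ T' ∧ Γ.tgt e = u ∨ Γ.src e = u ∧ Γ.tgt e ∈ T' := by
      rintro e (⟨h1, h2⟩ | ⟨h1, h2⟩) he
      · refine Or.inl ⟨h1, hbranch _ h1 _ ?_ h2 (adj_src_tgt e)⟩
        by_contra h3
        exact he (Or.inl ⟨hsub h1, h3⟩)
      · refine Or.inr ⟨hbranch _ h2 _ ?_ h1 (adj_src_tgt e).symm, h2⟩
        by_contra h3
        exact he (Or.inr ⟨h3, hsub h2⟩)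
    -- The edge `e₀` meets `T` only in `u`, so its chip, now at `u`, is free for the edge from `u`
    -- into `T'`.
    have he₀' : ¬ Γ.IsBoundary T' e₀ := by
      rintro (⟨h1, h2⟩ | ⟨h1, h2⟩) <;> rcases hu₀ with ⟨rfl, h4⟩ | ⟨h3, rfl⟩
      · exact huT' h1
      · exact h3 (hsub h1)
      · exact h4 (hsub h2)
      · exact huT' h2
    -- An edge that also leaves `T` keeps its chip at `x'`; the only other possible boundary edge of
    -- `T'` starts with the chip at its end `u`.
    obtain ⟨F', hF', hFF', hpos⟩ := ih _ hcard hT' (D := F)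
      (x := fun e => if Γ.IsBoundary T e then x' e else if Γ.src e ∈ T' then Γ.len e else 0)
      (by
        intro e _
        have := (Γ.len_pos e).le
        split_ifs with h
        · exact hx' e h
        · exact ⟨this, le_rfl⟩
        · exact ⟨le_rfl, this⟩)
      (by
        refine sum_single_le_of_injective hF
          (fun i => if h : Γ.IsBoundary T i.1 then ⟨i.1, h⟩ else ⟨e₀, he₀⟩) ?_ ?_
        · rintro ⟨e, he⟩ ⟨e', he'⟩ h
          dsimp only at h
          rw [Subtype.mk.injEq]
          split_ifs at h with h1 h2 h2
          · exact congrArg Subtype.val h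
          · obtain rfl : e = e₀ := congrArg Subtype.val h
            exact absurd he he₀'
          · obtain rfl : e₀ = e' := congrArg Subtype.val h
            exact absurd he' he₀'
          · apply eq_of_ends (Γ := Γ)
            rcases hinner e he h1 with ⟨a1, a2⟩ | ⟨a1, a2⟩ <;>
              rcases hinner e' he' h2 with ⟨b1, b2⟩ | ⟨b1, b2⟩
            · rw [huniq _ a1 _ b1 (a2 ▸ adj_src_tgt e) (b2 ▸ adj_src_tgt e'), a2, b2]
            · rw [huniq _ a1 _ b2 (a2 ▸ adj_src_tgt e) (b1 ▸ (adj_src_tgt e').symm), a2, b1,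
                Sym2.eq_swap]
            · rw [huniq _ a2 _ b1 (a1 ▸ (adj_src_tgt e).symm) (b2 ▸ adj_src_tgt e'), a1, b2,
                Sym2.eq_swap]
            · rw [huniq _ a2 _ b2 (a1 ▸ (adj_src_tgt e).symm) (b1 ▸ (adj_src_tgt e').symm), a1, b1]
        · rintro ⟨e, he⟩
          dsimp only
          split_ifs with h1 h2
          · rfl
          · rw [huF, Γ.edgePoint_of_len_le e le_rfl]
            rcases hinner e he h1 with ⟨a1, a2⟩ | ⟨a1, a2⟩
            · rw [a2]
            · rw [a1] at h2
              exact absurd h2 huT'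
          · rw [huF, Γ.edgePoint_of_nonpos e le_rfl]
            rcases hinner e he h1 with ⟨a1, a2⟩ | ⟨a1, a2⟩
            · exact absurd a1 h2
            · rw [a1])
      hvT' rfl
    exact ⟨F', hF', hDF.trans hFF', hpos⟩

/-- If the complement of `A` is a disjoint union of trees and no vertex in `A` has two neighbours in
the same tree, then the divisor consisting of one chip on each vertex in `A` has positive rank. -/
theorem IsTreeFamily.hasLinearSeries (Γ : MetricGraph G) {𝓕 : Set (Finset V)}
    (h𝓕 : IsTreeFamily G 𝓕) {A : Finset V}
    (hA : ∀ v ∉ A, ∃ T ∈ 𝓕, v ∈ T ∧ (∀ a ∈ T, ∀ b, b ∉ T → G.Adj a b → b ∈ A) ∧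
      ∀ b ∈ A, ∀ a ∈ T, ∀ a' ∈ T, G.Adj a b → G.Adj a' b → a = a') :
    Γ.HasLinearSeries 1 A.card := by
  classical
  set D : Γ.Divisor := ∑ a : {a // a ∈ A}, Finsupp.single (.vertex a.1) 1 with hD
  have hD0 : 0 ≤ D := nonneg_of_sum_single_le le_rfl
  refine ⟨D, ?_, rankAtLeast_one_of_vertices fun v => ?_⟩
  · rw [hD, degree_sum]
    simp [degree_single]
  by_cases hv : v ∈ A
  · exact ⟨D, hD0, LinEquiv.refl D,
      pos_of_sum_single_le (p := fun a : {a // a ∈ A} => Point.vertex a.1) le_rfl ⟨v, hv⟩⟩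
  obtain ⟨T, hT, hvT, hTA, huniq⟩ := hA v hv
  have hout : ∀ e, Γ.IsBoundary T e → (if Γ.src e ∈ T then Γ.tgt e else Γ.src e) ∈ A := by
    rintro e (⟨h1, h2⟩ | ⟨h1, h2⟩)
    · rw [if_pos h1]
      exact hTA _ h1 _ h2 (adj_src_tgt e)
    · rw [if_neg h1]
      exact hTA _ h2 _ h1 (adj_src_tgt e).symm
  -- The chips start at the outer ends of the boundary edges. These ends are distinct vertices of
  -- `A` because no vertex of `A` has two neighbours in `T`.
  refine h𝓕.exists_reach hT (x := fun e => if Γ.src e ∈ T then Γ.len e else 0) ?_ ?_ hvT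
  · intro e _
    have := (Γ.len_pos e).le
    split_ifs
    · exact ⟨this, le_rfl⟩
    · exact ⟨le_rfl, this⟩
  · refine sum_single_le_of_injective (p' := fun a : {a // a ∈ A} => Point.vertex a.1) le_rfl
      (fun i => ⟨_, hout i.1 i.2⟩) ?_ ?_
    · rintro ⟨e, he⟩ ⟨e', he'⟩ h
      rw [Subtype.mk.injEq] at h ⊢
      have hA' := hout e he
      dsimp only at h
      apply eq_of_ends (Γ := Γ)
      rcases he with ⟨a1, a2⟩ | ⟨a1, a2⟩ <;> rcases he' with ⟨b1, b2⟩ | ⟨b1, b2⟩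
      · rw [if_pos a1, if_pos b1] at h
        rw [if_pos a1] at hA'
        rw [huniq _ hA' _ a1 _ b1 (adj_src_tgt e) (h ▸ adj_src_tgt e'), h]
      · rw [if_pos a1, if_neg b1] at h
        rw [if_pos a1] at hA'
        rw [huniq _ hA' _ a1 _ b2 (adj_src_tgt e) (h ▸ (adj_src_tgt e').symm), h, Sym2.eq_swap]
      · rw [if_neg a1, if_pos b1] at h
        rw [if_neg a1] at hA'
        rw [huniq _ hA' _ a2 _ b1 (adj_src_tgt e).symm (h ▸ adj_src_tgt e'), h, Sym2.eq_swap]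
      · rw [if_neg a1, if_neg b1] at h
        rw [if_neg a1] at hA'
        rw [huniq _ hA' _ a2 _ b2 (adj_src_tgt e).symm (h ▸ (adj_src_tgt e').symm), h]
    · rintro ⟨e, he⟩
      dsimp only
      split_ifs with h
      · exact Γ.edgePoint_of_len_le e le_rfl
      · exact Γ.edgePoint_of_nonpos e le_rfl

end

/-! ### Verified searches for scrambles and tree covers -/

section

variable {V : Type} {G : SimpleGraph V}

theorem Linked.insert [DecidableEq V] {E : Finset V} (h : Linked G E) {u v : V} (hu : u ∈ E)
    (huv : G.Adj u v) : Linked G (insert v E) := by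
  intro p hp hex
  have hpE : ∀ w ∈ E, p w := by
    refine h p (fun a ha b hb => hp a (Finset.mem_insert_of_mem ha) b (Finset.mem_insert_of_mem hb))
      ?_
    obtain ⟨w, hw, hpw⟩ := hex
    rcases Finset.mem_insert.1 hw with rfl | hw
    · exact ⟨u, hu, hp w (Finset.mem_insert_self _ _) u (Finset.mem_insert_of_mem hu) huv.symm hpw⟩
    · exact ⟨w, hw, hpw⟩
  intro w hw
  rcases Finset.mem_insert.1 hw with rfl | hw
  · exact hp u (Finset.mem_insert_of_mem hu) w (Finset.mem_insert_self _ _) huv (hpE u hu)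
  · exact hpE w hw

/-- Every entry of the list, except for the last one, is adjacent to some later entry. -/
def IsGrown (G : SimpleGraph V) : List V → Prop
  | [] => True
  | v :: l => (l = [] ∨ ∃ u ∈ l, G.Adj u v) ∧ IsGrown G l

instance decidableIsGrown [DecidableEq V] [DecidableRel G.Adj] : DecidablePred (IsGrown G)
  | [] => inferInstanceAs (Decidable True)
  | v :: l =>
    have := decidableIsGrown l
    inferInstanceAs (Decidable ((l = [] ∨ ∃ u ∈ l, G.Adj u v) ∧ IsGrown G l))

theorem IsGrown.linked [DecidableEq V] : ∀ {l : List V}, IsGrown G l → Linked G l.toFinset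
  | [], _ => by intro p _ _ v hv; simp at hv
  | v :: l, h => by
    rw [List.toFinset_cons]
    rcases h.1 with rfl | ⟨u, hu, huv⟩
    · rintro p _ ⟨w, hw, hpw⟩ w' hw'
      simp at hw hw'
      rwa [hw', ← hw]
    · exact h.2.linked.insert (List.mem_toFinset.2 hu) huv

/-- The edges of a graph on natural numbers starting from `i`, given by the lists of the neighbours
preceding `i`, `i + 1`, ... -/
def edgeList : ℕ → List (List ℕ) → List (ℕ × ℕ)
  | _, [] => []
  | i, b :: bs => b.map (fun j => (j, i)) ++ edgeList (i + 1) bs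

/-- Check `leaf` for all extensions of a two-colouring `a` to further vertices, whose neighbours among
the previous ones are given by the lists, which bring about at most `k` further bichromatic edges. -/
def searchCut (leaf : List Bool → Bool) : List (List ℕ) → ℕ → List Bool → Bool
  | [], _, a => leaf a
  | b :: bs, k, a =>
    [true, false].all fun c => !((b.countP fun j => a.getD j false != c).ble k) ||
      searchCut leaf bs (k - b.countP fun j => a.getD j false != c) (a ++ [c])

/-- The neighbours in the lists precede the vertices `i`, `i + 1`, ... -/
def Precede : ℕ → List (List ℕ) → Prop
  | _, [] => True
  | i, b :: bs => (∀ j ∈ b, j < i) ∧ Precede (i + 1) bs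

instance decidablePrecede : ∀ i bs, Decidable (Precede i bs)
  | _, [] => inferInstanceAs (Decidable True)
  | i, b :: bs =>
    have := decidablePrecede (i + 1) bs
    inferInstanceAs (Decidable ((∀ j ∈ b, j < i) ∧ Precede (i + 1) bs))

/-- The colouring `x` is one branch of the search, and the bound on its bichromatic edges says that
this branch is never pruned. -/
theorem leaf_of_searchCut {leaf : List Bool → Bool} (x : ℕ → Bool) :
    ∀ {bs : List (List ℕ)} {k n : ℕ}, Precede n bs →
      searchCut leaf bs k ((List.range n).map x) = true →
      (edgeList n bs).countP (fun p => x p.1 != x p.2) ≤ k →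
      leaf ((List.range (n + bs.length)).map x) = true
  | [], _, _, _, h, _ => h
  | b :: bs, k, n, hb, h, hk => by
    -- The default of `getD` never matters, since all neighbours in `b` precede `n`.
    have hcount : b.countP (fun j => ((List.range n).map x).getD j false != x n) =
        b.countP (fun j => x j != x n) := by
      refine List.countP_congr fun j hj => ?_
      have := hb.1 j hj
      simp [List.getD, this]
    rw [edgeList, List.countP_append, List.countP_map] at hk
    have hk' : b.countP (fun j => x j != x n) + (edgeList (n + 1) bs).countP
        (fun p => x p.1 != x p.2) ≤ k := hk
    have hstep : (!((b.countP (fun j => ((List.range n).map x).getD j false != x n)).ble k) ||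
        searchCut leaf bs (k - b.countP (fun j => ((List.range n).map x).getD j false != x n))
          ((List.range n).map x ++ [x n])) = true := by
      rw [searchCut, List.all_eq_true] at h
      exact h (x n) (by cases x n <;> simp)
    rw [hcount, Nat.ble_eq_true_of_le (by omega), Bool.not_true, Bool.false_or] at hstep
    have h2 : (List.range n).map x ++ [x n] = (List.range (n + 1)).map x := by
      rw [List.range_succ, List.map_append]
      rfl
    rw [h2] at hstep
    have := leaf_of_searchCut x hb.2 hstep (by omega)
    rwa [List.length_cons, ← add_assoc, add_right_comm]

/-- One of the two colours does not contain any of the eggs. -/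
def noEgg (eggs : List (List ℕ)) (a : List Bool) : Bool :=
  -- The defaults place an index out of range in the colour under examination, so it never witnesses
  -- that an egg is not contained in it.
  (eggs.all fun E => E.any fun i => !a.getD i true) || eggs.all fun E => E.any fun i => a.getD i false

/-- Check that every set that contains `S` and at most `k` further elements misses an egg. -/
def searchHit (eggs : List (List ℕ)) : ℕ → List ℕ → Bool
  | 0, S => eggs.any fun E => E.all fun i => !S.contains i
  | k + 1, S => match eggs.find? fun E => E.all fun i => !S.contains i with
    | none => false
    | some E => E.all fun i => searchHit eggs k (i :: S)

/-- A set `T ⊇ S` that meets all eggs contains an element of the first egg missed by `S`. That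
element is not in `S`, so adding it uses up one unit of the budget. -/
theorem exists_egg_of_searchHit {eggs : List (List ℕ)} : ∀ {k : ℕ} {S : List ℕ},
    searchHit eggs k S = true → ∀ T : Finset ℕ, S.toFinset ⊆ T → T.card ≤ S.toFinset.card + k →
    ∃ E ∈ eggs, ∀ i ∈ E, i ∉ T
  | 0, S, h, T, hST, hk => by
    obtain rfl := Finset.eq_of_subset_of_card_le hST hk
    simpa [searchHit] using h
  | k + 1, S, h, T, hST, hk => by
    rw [searchHit] at h
    split at h
    · simp at h
    · rename_i E hE
      have hE' := List.find?_some hE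
      have hmem := List.mem_of_find?_eq_some hE
      simp only [List.all_eq_true, List.contains_eq_mem, Bool.not_eq_true',
        decide_eq_false_iff_not] at hE' h
      by_cases hT : ∀ i ∈ E, i ∉ T
      · exact ⟨E, hmem, hT⟩
      · push Not at hT
        obtain ⟨i, hi, hiT⟩ := hT
        refine exists_egg_of_searchHit (h i hi) T ?_ ?_
        · rw [List.toFinset_cons]
          exact Finset.insert_subset hiT hST
        · rw [List.toFinset_cons, Finset.card_insert_of_notMem (by simpa using hE' i hi)]
          omega

variable [Fintype V] [DecidableEq V]

/-- The lists need not describe all of `G`: further edges could only enlarge cuts, and vertices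
without a number belong to no egg. -/
theorem not_hasLinearSeries_of_search {Γ : MetricGraph G} {k : ℕ} (ν : ℕ → V)
    {bs eggs : List (List ℕ)} (hadj : ∀ p ∈ edgeList 0 bs, G.Adj (ν p.1) (ν p.2))
    (hnodup : ((edgeList 0 bs).map fun p => s(ν p.1, ν p.2)).Nodup)
    (hν : ((List.range bs.length).map ν).Nodup)
    (hne : ∀ E ∈ eggs, E ≠ []) (hlt : ∀ E ∈ eggs, ∀ i ∈ E, i < bs.length)
    (hgrown : ∀ E ∈ eggs, IsGrown G (E.map ν)) (hbs : Precede 0 bs)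
    (hhit : searchHit eggs k [] = true) (hcut : searchCut (noEgg eggs) bs k [] = true)
    {j : ℤ} (hj : j ≤ k) : ¬ Γ.HasLinearSeries 1 j := by
  have hinj : ∀ i < bs.length, ∀ j < bs.length, ν i = ν j → i = j := fun i hi j hj h =>
    List.inj_on_of_nodup_map hν (List.mem_range.2 hi) (List.mem_range.2 hj) h
  refine not_hasLinearSeries_of_scramble (k := k)
    (𝓔 := (eggs.map fun E => (E.map ν).toFinset).toFinset) ?_ ?_ ?_ ?_ hj
  · intro E hE
    simp only [List.mem_toFinset, List.mem_map] at hE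
    obtain ⟨E, hE, rfl⟩ := hE
    obtain ⟨i, hi⟩ := List.exists_mem_of_ne_nil E (hne E hE)
    exact ⟨ν i, List.mem_toFinset.2 (List.mem_map_of_mem hi)⟩
  · intro E hE
    simp only [List.mem_toFinset, List.mem_map] at hE
    obtain ⟨E, hE, rfl⟩ := hE
    exact (hgrown E hE).linked
  · intro S hS
    obtain ⟨E, hE, hET⟩ := exists_egg_of_searchHit hhit
      ((Finset.range bs.length).filter fun i => ν i ∈ S) (by simp) (by
        simp only [List.toFinset_nil, Finset.card_empty, zero_add]
        refine le_trans (Finset.card_le_card_of_injOn ν (fun i hi => ?_) ?_) hS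
        · simpa using (Finset.mem_filter.1 hi).2
        · intro i hi j hj h
          have hi := (Finset.mem_filter.1 hi).1
          have hj := (Finset.mem_filter.1 hj).1
          exact hinj i (by simpa using hi) j (by simpa using hj) h)
    refine ⟨_, List.mem_toFinset.2 (List.mem_map_of_mem hE), Finset.disjoint_left.2 fun v hv => ?_⟩
    simp only [List.mem_toFinset, List.mem_map] at hv
    obtain ⟨i, hi, rfl⟩ := hv
    intro hiS
    exact hET i hi (by simpa using ⟨hlt E hE i hi, hiS⟩)
  · intro U E hE E' hE' hEU hE'U
    simp only [List.mem_toFinset, List.mem_map] at hE hE'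
    obtain ⟨E, hE, rfl⟩ := hE
    obtain ⟨E', hE', rfl⟩ := hE'
    set x : ℕ → Bool := fun i => decide (ν i ∈ U) with hx
    -- Orients a bichromatic edge so that it leaves `U`.
    set φ : ℕ × ℕ → V × V := fun p => if x p.1 then (ν p.1, ν p.2) else (ν p.2, ν p.1) with hφ
    have hφs : ∀ p, s((φ p).1, (φ p).2) = s(ν p.1, ν p.2) := by
      intro p
      simp only [hφ]
      split_ifs
      · rfl
      · exact Sym2.eq_swap
    set l := (edgeList 0 bs).filter fun p => x p.1 != x p.2 with hl
    refine ⟨(l.map φ).toFinset, ?_, ?_⟩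
    · have hnd : (l.map φ).Nodup := by
        refine List.Nodup.of_map (fun q => s(q.1, q.2)) ?_
        rw [List.map_map]
        have : (fun q : V × V => s(q.1, q.2)) ∘ φ = fun p => s(ν p.1, ν p.2) := funext hφs
        rw [this]
        exact hnodup.sublist (List.filter_sublist.map _)
      rw [List.toFinset_card_of_nodup hnd, List.length_map, hl, ← List.countP_eq_length_filter]
      by_contra hle
      have hleaf := leaf_of_searchCut x hbs hcut (not_lt.1 hle)
      rw [zero_add, noEgg, Bool.or_eq_true, List.all_eq_true, List.all_eq_true] at hleaf
      rcases hleaf with h | h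
      · obtain ⟨i, hi, hxi⟩ := List.any_eq_true.1 (h E hE)
        have hiU : ν i ∈ U := hEU (List.mem_toFinset.2 (List.mem_map_of_mem hi))
        simp [List.getD, hlt E hE i hi, hx, hiU] at hxi
      · obtain ⟨i, hi, hxi⟩ := List.any_eq_true.1 (h E' hE')
        have hiU : ν i ∉ U := Finset.disjoint_left.1 hE'U
          (List.mem_toFinset.2 (List.mem_map_of_mem hi))
        simp [List.getD, hlt E' hE' i hi, hx, hiU] at hxi
    · intro m hm
      simp only [List.mem_toFinset, List.mem_map] at hm
      obtain ⟨p, hp, rfl⟩ := hm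
      obtain ⟨hp1, hp2⟩ := List.mem_filter.1 hp
      have hadj' := hadj p hp1
      simp only [hφ]
      by_cases h1 : ν p.1 ∈ U <;> by_cases h2 : ν p.2 ∈ U <;> simp [hx, h1, h2] at hp2 ⊢
      · exact hadj'
      · exact hadj'.symm

/-- The connected sets of vertices of a star, given by its centre and its other vertices. -/
def starParts (c : V) (l : List V) : List (List V) :=
  l.sublists.map (c :: ·) ++ l.map ([·])

/-- The vertex `b` has at most one neighbour in `T`. -/
def MeetsOnce (G : SimpleGraph V) (T : List V) (b : V) : Prop :=
  ∀ a ∈ T, ∀ a' ∈ T, G.Adj a b → G.Adj a' b → a = a'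

/-- `T'` is a union of components of `T` without `u`, with at most one edge to `u`. -/
def IsBranch (G : SimpleGraph V) (T : List V) (u : V) (T' : List V) : Prop :=
  T' ⊆ T ∧ u ∉ T' ∧ (∀ a ∈ T', ∀ b ∈ T, G.Adj a b → b ∈ T' ∨ b = u) ∧ MeetsOnce G T' u

/-- The neighbours of `T` belong to `A`, and each of them has only one neighbour in `T`. -/
def IsAttached (G : SimpleGraph V) (A T : List V) : Prop :=
  (∀ a ∈ T, ∀ b, G.Adj a b → b ∈ T ∨ b ∈ A) ∧ ∀ b ∈ A, MeetsOnce G T b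

/-- The lists in `F` form a tree family covering the complement of `A`, and no vertex in `A` has two
neighbours in one of them. -/
def IsTreeCover (G : SimpleGraph V) (A : List V) (F : List (List V)) : Prop :=
  (∀ T ∈ F, ∃ u ∈ T, ∃ w, w ∉ T ∧ G.Adj u w) ∧
  (∀ T ∈ F, ∀ u ∈ T, ∀ v ∈ T, v ≠ u → ∃ T' ∈ F, v ∈ T' ∧ IsBranch G T u T') ∧
  ∀ v, v ∈ A ∨ ∃ T ∈ F, v ∈ T ∧ IsAttached G A T

section Decidability

variable [DecidableRel G.Adj]

instance (T : List V) (b : V) : Decidable (MeetsOnce G T b) := by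
  unfold MeetsOnce
  infer_instance

instance (T T' : List V) (u : V) : Decidable (IsBranch G T u T') := by
  unfold IsBranch
  infer_instance

instance (A T : List V) : Decidable (IsAttached G A T) := by
  unfold IsAttached
  infer_instance

instance (A : List V) (F : List (List V)) : Decidable (IsTreeCover G A F) := by
  unfold IsTreeCover
  exact @instDecidableAnd _ _ inferInstance (@instDecidableAnd _ _ inferInstance inferInstance)

end Decidability

theorem IsTreeCover.hasLinearSeries (Γ : MetricGraph G) {A : List V} {F : List (List V)}
    (h : IsTreeCover G A F) (hA : A.Nodup) : Γ.HasLinearSeries 1 A.length := by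
  obtain ⟨h1, h2, h3⟩ := h
  have hF : IsTreeFamily G {T | ∃ l ∈ F, T = l.toFinset} := by
    refine ⟨?_, ?_⟩
    · rintro _ ⟨T, hT, rfl⟩
      obtain ⟨u, hu, w, hw, huw⟩ := h1 T hT
      exact ⟨u, by simpa using hu, w, by simpa using hw, huw⟩
    · rintro _ ⟨T, hT, rfl⟩ u hu v hv hvu
      obtain ⟨T', hT', hvT', hsub, huT', hb, h⟩ := h2 T hT u (by simpa using hu) v (by simpa using hv) hvu
      exact ⟨_, ⟨T', hT', rfl⟩, fun a ha => by simpa using hsub (by simpa using ha : a ∈ T'),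
        by simpa using hvT', by simpa using huT',
        fun a ha b hbT hbT' hab => (hb a (by simpa using ha) b (by simpa using hbT) hab).resolve_left
          (by simpa using hbT'), by simpa [MeetsOnce] using h⟩
  rw [← List.toFinset_card_of_nodup hA]
  refine hF.hasLinearSeries Γ fun v hv => ?_
  obtain ⟨T, hT, hvT, hb, h⟩ := (h3 v).resolve_left (by simpa using hv)
  refine ⟨_, ⟨T, hT, rfl⟩, by simpa using hvT, fun a ha b hbT hab => ?_,
    by simpa [MeetsOnce] using h⟩
  simpa using (hb a (by simpa using ha) b hab).resolve_left (by simpa using hbT)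

end

/-! ### The four graphs -/

open Sum

instance : DecidableRel (completeBipartiteGraph (Fin 3) (Fin 3)).Adj := fun a b =>
  inferInstanceAs (Decidable (a.isLeft ∧ b.isRight ∨ a.isRight ∧ b.isLeft))

instance : DecidableRel petersenGraph.Adj := fun s t =>
  inferInstanceAs (Decidable (Disjoint s.1 t.1))

instance decidableLeviGraph {P L : Type} (I : P → L → Prop) [∀ p l, Decidable (I p l)] :
    DecidableRel (leviGraph I).Adj
  | inl p, inr l => inferInstanceAs (Decidable (I p l))
  | inr l, inl p => inferInstanceAs (Decidable (I p l))
  | inl _, inl _ => inferInstanceAs (Decidable False)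
  | inr _, inr _ => inferInstanceAs (Decidable False)

instance : DecidableRel heawoodGraph.Adj :=
  decidableLeviGraph _

instance : DecidableRel pappusGraph.Adj :=
  decidableLeviGraph _

/-- The vertex `{a, b}` of the Petersen graph. -/
def pair (a b : Fin 5) (h : a ≠ b := by decide) : {s : Finset (Fin 5) // s.card = 2} :=
  ⟨{a, b}, Finset.card_pair h⟩

/-- All four graphs are cubic, so `m + 2` edges leave a tree with `m` vertices. Here one side
carries the chips and the trees are the three single vertices of the other side. -/
theorem completeBipartite_hasLinearSeries
    (Γ : MetricGraph (completeBipartiteGraph (Fin 3) (Fin 3))) : Γ.HasLinearSeries 1 3 :=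
  IsTreeCover.hasLinearSeries Γ (A := [inl 0, inl 1, inl 2])
    (F := starParts (inr 0) [] ++
      starParts (inr 1) [] ++
      starParts (inr 2) [])
    (by decide +kernel) (by decide +kernel)

/-- Three single vertices serve as eggs, since two edges do not disconnect the graph. As in the
other graphs below, every vertex after the first has an earlier neighbour in the numbering, which
makes bichromatic edges show up early in the search. -/
theorem completeBipartite_not_hasLinearSeries
    {Γ : MetricGraph (completeBipartiteGraph (Fin 3) (Fin 3))} {j : ℤ} (hj : j ≤ 2) :
    ¬ Γ.HasLinearSeries 1 j :=
  not_hasLinearSeries_of_search (k := 2)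
    (fun i => [
      inl 0, inr 0, inl 1, inr 1, inl 2, inr 2].getD i (inl 0))
    (bs := [
      [], [0], [1], [0, 2], [1, 3], [0, 2, 4]])
    (eggs := [
      [0], [4], [5]])
    (by decide +kernel) (by decide +kernel) (by decide +kernel) (by decide +kernel)
    (by decide +kernel) (by decide +kernel) (by decide +kernel) (by decide +kernel)
    (by decide +kernel) hj

/-- The chips lie on the pairs containing `0`. The remaining six pairs form three disjoint edges,
the splittings of `{1, 2, 3, 4}` into two pairs. -/
theorem petersen_hasLinearSeries (Γ : MetricGraph petersenGraph) : Γ.HasLinearSeries 1 4 :=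
  IsTreeCover.hasLinearSeries Γ (A := [pair 0 1, pair 0 2, pair 0 3, pair 0 4])
    (F := starParts (pair 1 2) [pair 3 4] ++
      starParts (pair 1 3) [pair 2 4] ++
      starParts (pair 1 4) [pair 2 3])
    (by decide +kernel) (by decide +kernel)

/-- The eggs are four pairwise disjoint edges, so three vertices cannot meet them all. -/
theorem petersen_not_hasLinearSeries {Γ : MetricGraph petersenGraph} {j : ℤ} (hj : j ≤ 3) :
    ¬ Γ.HasLinearSeries 1 j :=
  not_hasLinearSeries_of_search (k := 3)
    (fun i => [
      pair 0 1, pair 2 3, pair 0 4, pair 1 2, pair 3 4, pair 0 2,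
      pair 1 3, pair 1 4, pair 0 3, pair 2 4].getD i (pair 0 1))
    (bs := [
      [], [0], [1], [2], [0, 3], [4], [2, 5], [1, 5], [3, 7], [0, 6, 8]])
    (eggs := [
      [1, 2], [4, 3], [7, 8], [9, 0]])
    (by decide +kernel) (by decide +kernel) (by decide +kernel) (by decide +kernel)
    (by decide +kernel) (by decide +kernel) (by decide +kernel) (by decide +kernel)
    (by decide +kernel) hj

/-- Line `3` consists of the points `3, 4, 6`. Each of these forms a tree with its two other lines,
and any other point is joined to each of them by exactly one line. -/
theorem heawood_hasLinearSeries (Γ : MetricGraph heawoodGraph) : Γ.HasLinearSeries 1 5 :=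
  IsTreeCover.hasLinearSeries Γ (A := [inl 0, inl 1, inl 2, inl 5, inr 3])
    (F := starParts (inl 3) [inr 0, inr 2] ++
      starParts (inl 4) [inr 1, inr 4] ++
      starParts (inl 6) [inr 5, inr 6])
    (by decide +kernel) (by decide +kernel)

/-- The eggs are seven paths with three vertices. -/
theorem heawood_not_hasLinearSeries {Γ : MetricGraph heawoodGraph} {j : ℤ} (hj : j ≤ 4) :
    ¬ Γ.HasLinearSeries 1 j :=
  not_hasLinearSeries_of_search (k := 4)
    (fun i => [
      inl 0, inr 0, inl 1, inl 3, inr 1, inl 2, inr 2, inr 6, inl 4, inr 3, inl 6, inr 4,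
      inl 5, inr 5].getD i (inl 0))
    (bs := [
      [], [0], [1], [1], [2], [4], [3, 5], [0, 5], [4], [3, 8], [7, 9], [0, 8], [6, 11],
      [2, 10, 12]])
    (eggs := [
      [2, 1, 0], [5, 4, 2], [7, 13, 10], [8, 9, 3], [11, 1, 0], [11, 6, 12], [12, 6, 5]])
    (by decide +kernel) (by decide +kernel) (by decide +kernel) (by decide +kernel)
    (by decide +kernel) (by decide +kernel) (by decide +kernel) (by decide +kernel)
    (by decide +kernel) hj

/-- No two of the points `2, 5, 6` are collinear, and every line contains exactly one of them. So
their stars contain all nine lines, and each remaining point lies on one line of each star. -/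
theorem pappus_hasLinearSeries (Γ : MetricGraph pappusGraph) : Γ.HasLinearSeries 1 6 :=
  IsTreeCover.hasLinearSeries Γ (A := [inl 0, inl 1, inl 3, inl 4, inl 7, inl 8])
    (F := starParts (inl 2) [inr 0, inr 6, inr 8] ++
      starParts (inl 5) [inr 1, inr 5, inr 7] ++
      starParts (inl 6) [inr 2, inr 3, inr 4])
    (by decide +kernel) (by decide +kernel)

/-- The eggs are sixteen connected sets of four vertices. -/
theorem pappus_not_hasLinearSeries {Γ : MetricGraph pappusGraph} {j : ℤ} (hj : j ≤ 5) :
    ¬ Γ.HasLinearSeries 1 j :=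
  not_hasLinearSeries_of_search (k := 5)
    (fun i => [
      inl 0, inr 0, inl 1, inl 2, inr 3, inl 4, inr 8, inl 6, inr 4, inl 3, inr 1, inr 6,
      inl 5, inr 5, inl 7, inr 2, inl 8, inr 7].getD i (inl 0))
    (bs := [
      [], [0], [1], [1], [0], [4], [3, 5], [4], [2, 7], [8], [5, 9], [3, 9], [10], [0, 12],
      [11, 13], [7, 14], [6, 15], [2, 12, 16]])
    (eggs := [
      [4, 14, 15, 7], [6, 14, 11, 3], [8, 3, 1, 2], [8, 5, 10, 9], [9, 11, 1, 3],
      [10, 9, 8, 2], [11, 12, 10, 9], [12, 13, 1, 0], [12, 17, 8, 2], [13, 2, 1, 0],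
      [13, 7, 4, 0], [13, 16, 15, 14], [15, 16, 6, 5], [16, 6, 1, 3], [16, 6, 4, 5],
      [17, 12, 10, 5]])
    (by decide +kernel) (by decide +kernel) (by decide +kernel) (by decide +kernel)
    (by decide +kernel) (by decide +kernel) (by decide +kernel) (by decide +kernel)
    (by decide +kernel) hj

theorem isGonal_of_forall_le {V : Type} [Fintype V] {G : SimpleGraph V} {Γ : MetricGraph G}
    {n k : ℤ}
    (hn : 0 < n) (hnk : n = k + 1) (h : Γ.HasLinearSeries 1 n)
    (h' : ∀ {j : ℤ}, j ≤ k → ¬ Γ.HasLinearSeries 1 j) : Γ.IsGonal n :=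
  ⟨⟨hn, h⟩, fun j hj => by
    by_contra hlt
    exact h' (by omega : j ≤ k) hj.2⟩

end MetricGraph

theorem theorem4p2 :
    (∀ Γ : MetricGraph (completeBipartiteGraph (Fin 3) (Fin 3)), Γ.IsGonal 3) ∧
    (∀ Γ : MetricGraph petersenGraph, Γ.IsGonal 4) ∧
    (∀ Γ : MetricGraph heawoodGraph, Γ.IsGonal 5) ∧
    (∀ Γ : MetricGraph pappusGraph, Γ.IsGonal 6) :=
  ⟨fun Γ => MetricGraph.isGonal_of_forall_le (by norm_num) rfl
      Γ.completeBipartite_hasLinearSeries MetricGraph.completeBipartite_not_hasLinearSeries,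
    fun Γ => MetricGraph.isGonal_of_forall_le (by norm_num) rfl
      Γ.petersen_hasLinearSeries MetricGraph.petersen_not_hasLinearSeries,
    fun Γ => MetricGraph.isGonal_of_forall_le (by norm_num) rfl
      Γ.heawood_hasLinearSeries MetricGraph.heawood_not_hasLinearSeries,
    fun Γ => MetricGraph.isGonal_of_forall_le (by norm_num) rfl
      Γ.pappus_hasLinearSeries MetricGraph.pappus_not_hasLinearSeries⟩
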